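/- **Secular approximation of the Redfield equation.** Let $H=H^\dagger$ be an $n\times n$ complex matrix with spectral decomposition $H=\sum_m\varepsilon_mP_m$ (distinct $\varepsilon_m$), let $S_\alpha=S_\alpha^\dagger$ be finitely many $n\times n$ matrices, and let $C_{\alpha\beta}\in L^1(0,\infty)$ be complex-valued functions. Put $$\mathcal L_0\varrho=-\mathrm i[H,\varrho],\qquad E_\alpha=\sum_\beta\int_0^\infty C_{\alpha\beta}(\tau)\,\mathrm e^{\tau\mathcal L_0}S_\beta\,\mathrm d\tau,\qquad \mathcal D\varrho=\sum_\alpha[S_\alpha,\varrho E_\alpha^\dagger-E_\alpha\varrho],$$ so that $\kappa\mathcal L_0+\mathcal D$ is the Redfield generator. Let $\omega_1,\dots,\omega_m$ be the distinct differences $\varepsilon_k-\varepsilon_\ell$, let $\mathcal P_j\varrho=\sum_{\varepsilon_k-\varepsilon_\ell=\omega_j}P_k\varrho P_\ell$, and write $A(\omega_j)=\mathcal P_j(A)$. Put $\Gamma_{\alpha\beta}(\omega)=\int_0^\infty C_{\alpha\beta}(\tau)\mathrm e^{-\mathrm i\omega\tau}\mathrm d\tau$, $\gamma_{\alpha\beta}=\Gamma_{\alpha\beta}+\Gamma_{\beta\alpha}^*$,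 $\sigma_{\alpha\beta}=\frac1{2\mathrm i}(\Gamma_{\alpha\beta}-\Gamma_{\beta\alpha}^*)$, $H_{LS}=\sum_j\sum_{\alpha,\beta}\sigma_{\alpha\beta}(\omega_j)S_\alpha^\dagger(\omega_j)S_\beta(\omega_j)$, $$\mathcal D_{\rm sec}\varrho=-\mathrm i[H_{LS},\varrho]-\tfrac12\sum_j\sum_{\alpha,\beta}\gamma_{\alpha\beta}(\omega_j)\bigl(\{S_\alpha^\dagger(\omega_j)S_\beta(\omega_j),\varrho\}-2S_\beta(\omega_j)\varrho S_\alpha^\dagger(\omega_j)\bigr),\qquad \mathcal L_{\rm sec}=\kappa\mathcal L_0+\mathcal D_{\rm sec},$$ and $\mathcal D_Z=\sum_j\mathcal P_j\mathcal D\mathcal P_j$. Then: 1. $\mathcal L_0$ has spectrum $\{-\mathrm i\omega_j\}$ and spectral projections $\mathcal P_j$: $\mathcal L_0=-\mathrm i\sum_j\omega_j\mathcal P_j$, $\sum_j\mathcal P_j=1$, $\mathcal P_j\mathcal P_k=\delta_{jk}\mathcal P_j$. 2. $\lim_{\tau\to\infty}\frac1\tau\int_0^\tau\mathrm e^{-s\mathcal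 L_0}\mathcal D\,\mathrm e^{s\mathcal L_0}\,\mathrm ds=\mathcal D_Z$. 3. $\mathcal D_Z=\mathcal D_{\rm sec}$, including the Lamb-shift term. 4. If the $C_{\alpha\beta}$ are moreover environment correlation functions, i.e. defined on $\mathbb R$, continuous and of positive type ($\sum_{i,j,\alpha,\beta}\overline{z_{i\alpha}}\,C_{\alpha\beta}(t_i-t_j)\,z_{j\beta}\ge0$ for all finite families of times $t_i\in\mathbb R$ and coefficients $z_{i\alpha}\in\mathbb C$), then $\mathcal L_{\rm sec}$ is of GKLS form for all $\kappa\in\mathbb R$: $\mathcal L_{\rm sec}\varrho=-\mathrm i[K,\varrho]-\frac12\sum_kg_k(\{V_k^\dagger V_k,\varrho\}-2V_k\varrho V_k^\dagger)$ with $K=K^\dagger$, $g_k\ge0$. 5. Let $\|\cdot\|$ be any submultiplicative norm on the algebra of linear maps of $M_n(\mathbb C)$ (for instance an operator norm) with $\|\mathrm e^{t\mathcal L_0}\|\le1$ for all $t\ge0$, or the diamond norm $\|\Phi\|_\diamond=\sup_{\|A\|_1=1}\|(\Phi\otimes1_n)(A)\|_1$ (no further assumption). With $\Delta=\min_{j\ne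 k}|\omega_j-\omega_k|$ and $P=\max_j\|\mathcal P_j\|$, for all $\kappa>0$, $T\ge0$ and $t\in[0,T]$, $$\|\mathrm e^{t(\kappa\mathcal L_0+\mathcal D)}-\mathrm e^{t\mathcal L_{\rm sec}}\|\le\frac{2m(m-1)P^2\|\mathcal D\|}{\kappa\Delta}\,\mathrm e^{T\|\mathcal D_Z\|}\Bigl(1+T\mathrm e^{T\|\mathcal D\|}(\|\mathcal D\|+\|\mathcal D_Z\|)\Bigr),$$ where the right-hand side is read as $0$ if $m\le1$. -/

import Mathlib

open MeasureTheory Set Filter Topology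
open scoped Matrix ComplexOrder

-- The entrywise sup norm on matrices is used for the topology and the vector-valued integrals only.
-- It induces the product topology, whose separate instances are switched off to avoid duplicates.
attribute [local instance] Matrix.normedAddCommGroup Matrix.normedSpace
attribute [-instance] instTopologicalSpaceMatrix Matrix.instUniformSpace

noncomputable section

namespace Secular

section Superoperators

variable {n : Type*} [Fintype n] [DecidableEq n]

/-- Superoperators: linear maps on the space of complex `n × n` matrices (automatically
continuous). -/
abbrev Superop (n : Type*) [Fintype n] [DecidableEq n] : Type _ :=
  Matrix n n ℂ →L[ℂ] Matrix n n ℂ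

/-- The superoperator `ρ ↦ A ρ B`. -/
def sandwich (A B : Matrix n n ℂ) : Superop n :=
  LinearMap.toContinuousLinearMap (LinearMap.mulLeft ℂ A ∘ₗ LinearMap.mulRight ℂ B)

theorem sandwich_apply (A B ρ : Matrix n n ℂ) : sandwich A B ρ = A * (ρ * B) := rfl

/-- The superoperator `ρ ↦ [A, ρ]`. -/
def commSup (A : Matrix n n ℂ) : Superop n := sandwich A 1 - sandwich 1 A

/-- The superoperator `ρ ↦ {A, ρ}`. -/
def anticommSup (A : Matrix n n ℂ) : Superop n := sandwich A 1 + sandwich 1 A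

/-- The free generator `𝓛₀ ρ = -i[H, ρ]`. -/
def freeGen (H : Matrix n n ℂ) : Superop n := (-Complex.I) • commSup H

/-- A superoperator of Gorini-Kossakowski-Lindblad-Sudarshan form. -/
def IsGKLS (L : Superop n) : Prop :=
  ∃ (K : Matrix n n ℂ) (r : ℕ) (g : Fin r → ℝ) (V : Fin r → Matrix n n ℂ),
    K.IsHermitian ∧ (∀ k, 0 ≤ g k) ∧
    L = (-Complex.I) • commSup K
      - (1 / 2 : ℂ) • ∑ k, (g k : ℂ) •
          (anticommSup ((V k)ᴴ * V k) - (2 : ℂ) • sandwich (V k) (V k)ᴴ)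

/-- The trace norm `tr √(Aᴴ A)`, i.e. the sum of the singular values of `A`. -/
def traceNorm {k : Type*} [Fintype k] [DecidableEq k] (A : Matrix k k ℂ) : ℝ :=
  ∑ i, √((Matrix.isHermitian_conjTranspose_mul_self A).eigenvalues i)

/-- The extension `Φ ⊗ 1` of a superoperator to the matrices on `ℂⁿ ⊗ ℂⁿ`. -/
def ampliation (Φ : Superop n) (A : Matrix (n × n) (n × n) ℂ) : Matrix (n × n) (n × n) ℂ :=
  Matrix.of fun p q => Φ (Matrix.of fun i j => A (i, p.2) (j, q.2)) p.1 q.1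

/-- The diamond norm `‖Φ‖_⋄ = sup {‖(Φ ⊗ 1)(A)‖₁ : ‖A‖₁ = 1}`. -/
def diamondNorm (Φ : Superop n) : ℝ :=
  sSup {x | ∃ A : Matrix (n × n) (n × n) ℂ, traceNorm A = 1 ∧ x = traceNorm (ampliation Φ A)}

end Superoperators

section Spectral

variable {n : Type*} [Fintype n] [DecidableEq n] {H : Matrix n n ℂ}

/-- The distinct eigenvalues `ε_m` of `H`. -/
def energies (hH : H.IsHermitian) : Finset ℝ := Finset.univ.image hH.eigenvalues

/-- The orthogonal projection onto the eigenspace of `H` for the eigenvalue `ε`. -/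
def eigProj (hH : H.IsHermitian) (ε : ℝ) : Matrix n n ℂ :=
  (hH.eigenvectorUnitary : Matrix n n ℂ)
    * Matrix.diagonal (fun i => if hH.eigenvalues i = ε then 1 else 0)
    * (hH.eigenvectorUnitary : Matrix n n ℂ)ᴴ

/-- The distinct Bohr frequencies `ω_j`: all differences `ε_m - ε_n` of eigenvalues of `H`. -/
def bohr (hH : H.IsHermitian) : Finset ℝ :=
  (energies hH ×ˢ energies hH).image fun p => p.1 - p.2

/-- The superoperator `𝓟_ω ρ = ∑_{m,n : ε_m - ε_n = ω} P_m ρ P_n`. -/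
def freqProj (hH : H.IsHermitian) (ω : ℝ) : Superop n :=
  ∑ p ∈ energies hH ×ˢ energies hH,
    if p.1 - p.2 = ω then sandwich (eigProj hH p.1) (eigProj hH p.2) else 0

/-- The average `D_Z = ∑_j 𝓟_j D 𝓟_j`. -/
def zenoAverage (hH : H.IsHermitian) (D : Superop n) : Superop n :=
  ∑ ω ∈ bohr hH, freqProj hH ω * D * freqProj hH ω

/-- The minimal gap `Δ` between distinct eigenvalues `-iω_j` of the free generator
(relevant only when there are at least two of them). -/
def gap (hH : H.IsHermitian) : ℝ :=
  sInf {x | ∃ ω ∈ bohr hH, ∃ ω' ∈ bohr hH, ω ≠ ω' ∧ x = |ω - ω'|}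

/-- The maximum `P` of the norms of the projections `𝓟_j`, measured by `N`. -/
def maxProjNorm (hH : H.IsHermitian) (N : Superop n → ℝ) : ℝ :=
  sSup ((fun ω => N (freqProj hH ω)) '' (bohr hH : Set ℝ))

/-- `(2 m (m-1) P² ‖D‖ / (κ Δ)) e^{T‖D_Z‖} (1 + T e^{T‖D‖} (‖D‖ + ‖D_Z‖))`, norms measured
by `N`. -/
def errorBound (hH : H.IsHermitian) (D : Superop n) (N : Superop n → ℝ) (κ T : ℝ) : ℝ :=
  2 * (bohr hH).card * ((bohr hH).card - 1) * maxProjNorm hH N ^ 2 * N D / (κ * gap hH)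
    * Real.exp (T * N (zenoAverage hH D))
    * (1 + T * Real.exp (T * N D) * (N D + N (zenoAverage hH D)))

end Spectral

section Redfield

variable {n ι : Type*} [Fintype n] [DecidableEq n] [Fintype ι] {H : Matrix n n ℂ}

/-- `E_α = ∑_β ∫₀^∞ C_{αβ}(τ) e^{τ𝓛₀} S_β dτ`. -/
def bathOp (H : Matrix n n ℂ) (S : ι → Matrix n n ℂ) (C : ι → ι → ℝ → ℂ) (α : ι) :
    Matrix n n ℂ :=
  ∑ β, ∫ τ in Ioi (0 : ℝ), C α β τ • (NormedSpace.exp ((τ : ℂ) • freeGen H)) (S β)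

/-- The Redfield dissipator `D ρ = ∑_α [S_α, ρ E_α† - E_α ρ]`. -/
def redfield (H : Matrix n n ℂ) (S : ι → Matrix n n ℂ) (C : ι → ι → ℝ → ℂ) : Superop n :=
  ∑ α, commSup (S α) * (sandwich 1 (bathOp H S C α)ᴴ - sandwich (bathOp H S C α) 1)

/-- `Γ_{αβ}(ω) = ∫₀^∞ C_{αβ}(τ) e^{-iωτ} dτ`. -/
def bathGamma (C : ι → ι → ℝ → ℂ) (ω : ℝ) (α β : ι) : ℂ :=
  ∫ τ in Ioi (0 : ℝ), C α β τ * Complex.exp (-Complex.I * ω * τ)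

/-- `γ_{αβ}(ω) = Γ_{αβ}(ω) + Γ_{βα}(ω)^*`. -/
def decayRate (C : ι → ι → ℝ → ℂ) (ω : ℝ) (α β : ι) : ℂ :=
  bathGamma C ω α β + star (bathGamma C ω β α)

/-- `σ_{αβ}(ω) = (Γ_{αβ}(ω) - Γ_{βα}(ω)^*) / (2i)`. -/
def lambCoeff (C : ι → ι → ℝ → ℂ) (ω : ℝ) (α β : ι) : ℂ :=
  1 / (2 * Complex.I) * (bathGamma C ω α β - star (bathGamma C ω β α))

/-- The Lamb-shift Hamiltonian `∑_j ∑_{α,β} σ_{αβ}(ω_j) S_α†(ω_j) S_β(ω_j)`, where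
`S_α(ω_j) = 𝓟_j S_α`. -/
def lambShift (hH : H.IsHermitian) (S : ι → Matrix n n ℂ) (C : ι → ι → ℝ → ℂ) :
    Matrix n n ℂ :=
  ∑ ω ∈ bohr hH, ∑ α, ∑ β, lambCoeff C ω α β •
    ((freqProj hH ω (S α))ᴴ * freqProj hH ω (S β))

/-- The secular dissipator `D_sec ρ = -i[H_LS, ρ]
- ½ ∑_j ∑_{α,β} γ_{αβ}(ω_j) ({S_α†(ω_j) S_β(ω_j), ρ} - 2 S_β(ω_j) ρ S_α†(ω_j))`. -/
def secular (hH : H.IsHermitian) (S : ι → Matrix n n ℂ) (C : ι → ι → ℝ → ℂ) : Superop n :=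
  (-Complex.I) • commSup (lambShift hH S C)
    - (1 / 2 : ℂ) • ∑ ω ∈ bohr hH, ∑ α, ∑ β, decayRate C ω α β •
        (anticommSup ((freqProj hH ω (S α))ᴴ * freqProj hH ω (S β))
          - (2 : ℂ) • sandwich (freqProj hH ω (S β)) (freqProj hH ω (S α))ᴴ)

/-- Two-time correlation functions of a stationary environment,
`C_{αβ}(s - t) = ⟨B_α(s) B_β(t)⟩` with self-adjoint `B_α`: they are continuous and of positive
type, since `⟨X† X⟩ ≥ 0` for `X = ∑_{j,β} z_{jβ} B_β(t_j)`. -/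
def IsCorrelation (C : ι → ι → ℝ → ℂ) : Prop :=
  (∀ α β, Continuous (C α β)) ∧
  ∀ (r : ℕ) (t : Fin r → ℝ) (z : Fin r → ι → ℂ),
    0 ≤ ∑ i, ∑ j, ∑ α, ∑ β, star (z i α) * C α β (t i - t j) * z j β

end Redfield

end Secular

end

/-! In an eigenbasis of `H` the free generator multiplies the entry `(i, j)` of a matrix by `-i(ε_i
- ε_j)`. Such entrywise multipliers are the image of an injective algebra homomorphism, `schurHom`,
from functions on index pairs, so the spectrum, the exponential and the projections of the free
generator are computed pointwise.

Conjugation by the free evolution gives the block `𝓟_ω D 𝓟_ω'` the phase `e^{i(ω-ω')s}`, so the time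
average keeps only the diagonal blocks. For `ρ ↦ A ρ B` this couples components of `A` and `Bᴴ` of
equal frequency (`zenoAverage_sandwich`). In the Redfield case the coefficients that appear are
`Γ_{αβ}(ω)`; their Hermitian and anti-Hermitian parts in `α, β` give the decay rates and the Lamb
shift.

GKLS form reduces to `γ(ω) ≥ 0`. The number `x†γ(ω)x` is twice the real part of the half-line
integral of a scalar function of positive type; Fejér-weighted integrals of its real part are limits
of nonnegative quadratic forms. Splitting `γ(ω)` into rank-one terms then produces the jump
operators.

For the error bound, the off-diagonal part of `D` is a commutator: `D - D_Z = [G, κ𝓛₀]` with `G` of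
order `1/(κΔ)`. Inserting `1 + G` between the two evolutions cancels `D - D_Z` in the derivative and
leaves only terms proportional to `G` (`algebraNorm_exp_sub_exp_le`). The norm of `𝓛₀` never enters,
because the free evolution is contractive. In the diamond norm contractivity follows from unitarity,
through the duality between trace norm and contractions. -/

namespace Secular

/-! ### Perturbation of contraction semigroups in an algebra norm -/

section Perturbation

variable {𝔸 : Type*} [NormedRing 𝔸] [NormedAlgebra ℂ 𝔸]

/-- Every algebra norm on a finite-dimensional normed algebra is continuous. -/
theorem continuous_algebraNorm [FiniteDimensional ℂ 𝔸] (N : AlgebraNorm ℂ 𝔸) :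
    Continuous N := by
  have hconv : ConvexOn ℝ univ (N.toSeminorm : 𝔸 → ℝ) := N.toSeminorm.convexOn
  have : FiniteDimensional ℝ 𝔸 := FiniteDimensional.trans ℝ ℂ 𝔸
  have := hconv.continuousOn isOpen_univ
  exact continuousOn_univ.1 this

theorem algebraNorm_real_smul (N : AlgebraNorm ℂ 𝔸) (r : ℝ) (x : 𝔸) :
    N (r • x) = |r| * N x := by
  rw [← Complex.coe_smul, map_smul_eq_mul, Complex.norm_real, Real.norm_eq_abs]

theorem hasDerivAt_exp_ofReal_smul [CompleteSpace 𝔸] (X : 𝔸) (s : ℝ) :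
    HasDerivAt (fun u : ℝ => NormedSpace.exp ((u : ℂ) • X))
      (NormedSpace.exp ((s : ℂ) • X) * X) s := by
  have h := (hasDerivAt_exp_smul_const (𝕂 := ℂ) X (s : ℂ)).scomp s Complex.ofRealCLM.hasDerivAt
  simpa [Function.comp_def] using h

theorem hasDerivAt_exp_ofReal_smul' [CompleteSpace 𝔸] (X : 𝔸) (s : ℝ) :
    HasDerivAt (fun u : ℝ => NormedSpace.exp ((u : ℂ) • X))
      (X * NormedSpace.exp ((s : ℂ) • X)) s := by
  have h := (hasDerivAt_exp_smul_const' (𝕂 := ℂ) X (s : ℂ)).scomp s Complex.ofRealCLM.hasDerivAt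
  simpa [Function.comp_def] using h

theorem exp_ofReal_add_smul [CompleteSpace 𝔸] (X : 𝔸) (s t : ℝ) :
    NormedSpace.exp (((s + t : ℝ) : ℂ) • X)
      = NormedSpace.exp ((s : ℂ) • X) * NormedSpace.exp ((t : ℂ) • X) := by
  let _ : NormedAlgebra ℚ 𝔸 := NormedAlgebra.restrictScalars ℚ ℂ 𝔸
  rw [← NormedSpace.exp_add_of_commute (((Commute.refl X).smul_left _).smul_right _), ← add_smul]
  push_cast; rfl

/-- A contraction semigroup with a bounded perturbation of its generator. -/
theorem algebraNorm_exp_add_le [CompleteSpace 𝔸] (N : AlgebraNorm ℂ 𝔸) (hN : Continuous N)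
    {A : 𝔸} (hA : ∀ t : ℝ, 0 ≤ t → N (NormedSpace.exp ((t : ℂ) • A)) ≤ 1) (D : 𝔸)
    {t : ℝ} (ht : 0 ≤ t) :
    N (NormedSpace.exp ((t : ℂ) • (A + D))) ≤ Real.exp (t * N D) := by
  have hcont : Continuous fun u : ℝ => NormedSpace.exp ((u : ℂ) • (A + D)) :=
    continuous_iff_continuousAt.2 fun s => (hasDerivAt_exp_ofReal_smul (A + D) s).continuousAt
  -- Grönwall in its right-derivative form, since `N` need not be differentiable along the curve.
  -- The initial value is at most 1 by `hA` at time 0; submultiplicativity alone would not bound `N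
  -- 1` above.
  have key := le_gronwallBound_of_liminf_deriv_right_le
    (f := fun u : ℝ => N (NormedSpace.exp ((u : ℂ) • (A + D))))
    (f' := fun u : ℝ => N D * N (NormedSpace.exp ((u : ℂ) • (A + D))))
    (δ := 1) (K := N D) (ε := 0) (a := 0) (b := t) (hN.comp hcont).continuousOn ?_ ?_ ?_ t ⟨ht, le_rfl⟩
  · rw [gronwallBound_ε0, one_mul, sub_zero, mul_comm] at key
    exact key
  · intro x _ r hr
    -- Comparing with the unperturbed semigroup removes `A` from the derivative at 0, so the growth
    -- rate is `N D` and not `N (A + D)`.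
    have hd : HasDerivAt (fun u : ℝ => NormedSpace.exp ((u : ℂ) • (A + D))
        - NormedSpace.exp ((u : ℂ) • A)) D 0 := by
      refine ((hasDerivAt_exp_ofReal_smul (A + D) 0).fun_sub
        (hasDerivAt_exp_ofReal_smul A 0)).congr_deriv ?_
      simp [NormedSpace.exp_zero]
    have hs := hd.tendsto_slope_zero_right
    simp only [zero_add, Complex.ofReal_zero, zero_smul, NormedSpace.exp_zero, sub_self,
      sub_zero] at hs
    have h2 : Tendsto (fun h : ℝ => N (h⁻¹ • (NormedSpace.exp ((h : ℂ) • (A + D))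
        - NormedSpace.exp ((h : ℂ) • A))) * N (NormedSpace.exp ((x : ℂ) • (A + D)))) (𝓝[>] 0)
        (𝓝 (N D * N (NormedSpace.exp ((x : ℂ) • (A + D))))) :=
      ((hN.tendsto D).comp hs).mul_const _
    have h3 := h2.eventually (gt_mem_nhds hr)
    have h4 : Tendsto (fun z : ℝ => z - x) (𝓝[>] x) (𝓝[>] 0) := by
      refine tendsto_nhdsWithin_iff.2 ⟨?_, ?_⟩
      · have : Tendsto (fun z : ℝ => z - x) (𝓝 x) (𝓝 (x - x)) := tendsto_id.sub_const x
        rw [sub_self] at this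
        exact this.mono_left nhdsWithin_le_nhds
      · filter_upwards [self_mem_nhdsWithin] with z hz
        exact sub_pos.2 (mem_Ioi.1 hz)
    refine Eventually.frequently ?_
    filter_upwards [h4.eventually h3, self_mem_nhdsWithin] with z hz hzx
    refine lt_of_le_of_lt ?_ hz
    have hpos : 0 < z - x := sub_pos.2 (mem_Ioi.1 hzx)
    set h := z - x with hh
    have hz' : z = h + x := by simp [hh]
    rw [algebraNorm_real_smul, abs_of_pos (inv_pos.2 hpos), mul_assoc]
    refine mul_le_mul_of_nonneg_left ?_ (inv_pos.2 hpos).le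
    rw [hz', exp_ofReal_add_smul]
    have e1 : N (NormedSpace.exp ((h : ℂ) • (A + D))) ≤
        N (NormedSpace.exp ((h : ℂ) • (A + D)) - NormedSpace.exp ((h : ℂ) • A)) + 1 := by
      calc _ = N ((NormedSpace.exp ((h : ℂ) • (A + D)) - NormedSpace.exp ((h : ℂ) • A))
              + NormedSpace.exp ((h : ℂ) • A)) := by rw [sub_add_cancel]
        _ ≤ _ := (map_add_le_add N _ _).trans (by gcongr; exact hA h hpos.le)
    have e2 := map_mul_le_mul N (NormedSpace.exp ((h : ℂ) • (A + D)))
      (NormedSpace.exp ((x : ℂ) • (A + D)))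
    have e3 := mul_le_mul_of_nonneg_right e1 (apply_nonneg N (NormedSpace.exp ((x : ℂ) • (A + D))))
    linarith
  · simpa using hA 0 le_rfl
  · intro x _
    simp

/-- Mean value inequality for an algebra norm. -/
theorem algebraNorm_image_sub_le (N : AlgebraNorm ℂ 𝔸) (hN : Continuous N) {g g' : ℝ → 𝔸}
    (hg : ∀ s, HasDerivAt g (g' s) s) {t c : ℝ} (ht : 0 ≤ t) (hc : ∀ s ∈ Ico 0 t, N (g' s) ≤ c) :
    N (g t - g 0) ≤ c * t := by
  have hcont : Continuous g := continuous_iff_continuousAt.2 fun s => (hg s).continuousAt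
  have key := le_gronwallBound_of_liminf_deriv_right_le
    (f := fun u : ℝ => N (g u - g 0)) (f' := fun u => N (g' u))
    (δ := 0) (K := 0) (ε := c) (a := 0) (b := t)
    (hN.comp (hcont.sub continuous_const)).continuousOn ?_ ?_ ?_ t ⟨ht, le_rfl⟩
  · simpa [gronwallBound_K0] using key
  · intro x _ r hr
    have hs := (hasDerivWithinAt_iff_tendsto_slope' (s := Ioi x) (by simp)).1
      (hg x).hasDerivWithinAt
    have h3 := ((hN.tendsto _).comp hs).eventually (gt_mem_nhds hr)
    refine Eventually.frequently ?_
    filter_upwards [h3, self_mem_nhdsWithin] with z hz hzx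
    refine lt_of_le_of_lt ?_ hz
    have hpos : 0 < z - x := sub_pos.2 (mem_Ioi.1 hzx)
    simp only [Function.comp_apply, slope_def_module]
    rw [algebraNorm_real_smul, abs_of_pos (inv_pos.2 hpos)]
    refine mul_le_mul_of_nonneg_left ?_ (inv_pos.2 hpos).le
    have := map_add_le_add N (g z - g x) (g x - g 0)
    rw [sub_add_sub_cancel] at this
    linarith
  · simp
  · intro x hx
    simpa using hc x hx

/-- Two perturbations `D`, `Z` of a contractive generator `A` which differ by a commutator
`[G, A]` generate evolutions at a distance of order `‖G‖`. -/
theorem algebraNorm_exp_sub_exp_le [CompleteSpace 𝔸] (N : AlgebraNorm ℂ 𝔸) (hN : Continuous N)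
    {A D Z G : 𝔸} (hA : ∀ t : ℝ, 0 ≤ t → N (NormedSpace.exp ((t : ℂ) • A)) ≤ 1)
    (hG : G * A - A * G = D - Z) {t T : ℝ} (ht : 0 ≤ t) (htT : t ≤ T) :
    N (NormedSpace.exp ((t : ℂ) • (A + D)) - NormedSpace.exp ((t : ℂ) • (A + Z)))
      ≤ 2 * N G * (Real.exp (T * N Z) * (1 + T * Real.exp (T * N D) * (N D + N Z))) := by
  have hD0 := apply_nonneg N D
  have hZ0 := apply_nonneg N Z
  have hG0 := apply_nonneg N G
  have hT : 0 ≤ T := ht.trans htT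
  let X : ℝ → 𝔸 := fun s => NormedSpace.exp ((s : ℂ) • (A + D))
  let Y : ℝ → 𝔸 := fun s => NormedSpace.exp ((s : ℂ) • (A + Z))
  have hX : ∀ s, 0 ≤ s → N (X s) ≤ Real.exp (s * N D) := fun s hs =>
    algebraNorm_exp_add_le N hN hA D hs
  have hY : ∀ s, 0 ≤ s → N (Y s) ≤ Real.exp (s * N Z) := fun s hs =>
    algebraNorm_exp_add_le N hN hA Z hs
  have hX' : ∀ s, HasDerivAt (fun u => X (t - u)) (-(X (t - s) * (A + D))) s := by
    intro s
    have h1 : HasDerivAt (fun u : ℝ => t - u) (-1) s := by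
      simpa using (hasDerivAt_id s).const_sub t
    exact ((hasDerivAt_exp_ofReal_smul (A + D) (t - s)).scomp s h1).congr_deriv (neg_one_smul ℝ _)
  have hY' : ∀ s, HasDerivAt Y ((A + Z) * Y s) s := fun s => hasDerivAt_exp_ofReal_smul' (A + Z) s
  -- Differentiating the second summand gives `X (Z - D) Y`; the first gives `X ([G, A] + G Z - D G)
  -- Y`, and `[G, A] = D - Z` cancels it.
  let g : ℝ → 𝔸 := fun s => X (t - s) * G * Y s + X (t - s) * Y s
  have hg : ∀ s, HasDerivAt g (X (t - s) * (G * Z - D * G) * Y s) s := by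
    intro s
    have h := (((hX' s).mul_const G).mul (hY' s)).add ((hX' s).mul (hY' s))
    refine h.congr_deriv ?_
    have e : X (t - s) * (G * A - A * G - (D - Z)) * Y s = 0 := by rw [hG, sub_self]; simp
    rw [← sub_eq_zero, ← e]
    noncomm_ring
  have hmv := algebraNorm_image_sub_le N hN hg ht
    (c := Real.exp (T * N D) * (N G * (N D + N Z)) * Real.exp (T * N Z)) (by
      intro s hs
      have hs1 : N (X (t - s)) ≤ Real.exp (T * N D) :=
        (hX _ (by linarith [hs.2])).trans (Real.exp_le_exp.2 (by
          refine mul_le_mul_of_nonneg_right ?_ hD0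
          linarith [hs.1]))
      have hs2 : N (Y s) ≤ Real.exp (T * N Z) :=
        (hY _ hs.1).trans (Real.exp_le_exp.2 (by
          refine mul_le_mul_of_nonneg_right ?_ hZ0
          linarith [hs.2]))
      have hs3 : N (G * Z - D * G) ≤ N G * (N D + N Z) := by
        have a1 := map_sub_le_add N (G * Z) (D * G)
        have a2 := map_mul_le_mul N G Z
        have a3 := map_mul_le_mul N D G
        nlinarith
      refine (map_mul_le_mul N _ _).trans (mul_le_mul ((map_mul_le_mul N _ _).trans
        (mul_le_mul hs1 hs3 (apply_nonneg N _) (Real.exp_pos _).le)) hs2 (apply_nonneg N _) ?_)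
      positivity)
  have hX0 : X 0 = 1 := by simp [X, NormedSpace.exp_zero]
  have hY0 : Y 0 = 1 := by simp [Y, NormedSpace.exp_zero]
  have hfin : X t - Y t = G * Y t - X t * G - (g t - g 0) := by
    simp only [g, sub_self, sub_zero, hX0, hY0]
    noncomm_ring
  change N (X t - Y t) ≤ _
  have b1 : N (X t) ≤ Real.exp (T * N D) := (hX t ht).trans (Real.exp_le_exp.2 (by gcongr))
  have b2 : N (Y t) ≤ Real.exp (T * N Z) := (hY t ht).trans (Real.exp_le_exp.2 (by gcongr))
  have c0 : N (X t - Y t) ≤ N G * N (Y t) + N (X t) * N G + N (g t - g 0) := by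
    rw [hfin]
    have a1 := map_sub_le_add N (G * Y t - X t * G) (g t - g 0)
    have a2 := map_sub_le_add N (G * Y t) (X t * G)
    have a3 := map_mul_le_mul N G (Y t)
    have a4 := map_mul_le_mul N (X t) G
    linarith
  set x := Real.exp (T * N D)
  set y := Real.exp (T * N Z)
  have hy1 : 1 ≤ y := Real.one_le_exp (by positivity)
  have hx0 : 0 < x := Real.exp_pos _
  -- This is `e^{-a} ≥ 1 - a` multiplied by `e^a`, with `a = T * N D`. It puts the boundary term `X
  -- t * G` into the shape of the other terms, so that everything sums to the factor 2.
  have hx1 : x ≤ 1 + T * x * N D := by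
    have h1 := Real.add_one_le_exp (-(T * N D))
    have h2 : x * Real.exp (-(T * N D)) = 1 := by
      rw [← Real.exp_add, add_neg_cancel, Real.exp_zero]
    nlinarith
  have hx2 : x ≤ y * (1 + T * x * (N D + N Z)) := by
    have h1 : 1 + T * x * N D ≤ 1 + T * x * (N D + N Z) := by
      have : 0 ≤ T * x * N Z := by positivity
      linarith
    have h2 : 0 ≤ 1 + T * x * (N D + N Z) := by positivity
    calc x ≤ 1 * (1 + T * x * (N D + N Z)) := by linarith
      _ ≤ _ := mul_le_mul_of_nonneg_right hy1 h2
  have c1 : N G * N (Y t) ≤ N G * y := by gcongr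
  have c2 : N (X t) * N G ≤ N G * (y * (1 + T * x * (N D + N Z))) := by
    rw [mul_comm]
    gcongr
    exact b1.trans hx2
  have c3 : N (g t - g 0) ≤ x * (N G * (N D + N Z)) * y * T :=
    hmv.trans (by gcongr)
  linarith

end Perturbation

/-! ### Entrywise multipliers in a unitary basis -/

section SchurMultipliers

variable {n : Type*} [Fintype n] [DecidableEq n]

theorem unitary_conjTranspose_mul (V : Matrix.unitaryGroup n ℂ) :
    (V : Matrix n n ℂ)ᴴ * (V : Matrix n n ℂ) = 1 := by
  rw [← Matrix.star_eq_conjTranspose]; exact Unitary.coe_star_mul_self V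

theorem unitary_mul_conjTranspose (V : Matrix.unitaryGroup n ℂ) :
    (V : Matrix n n ℂ) * (V : Matrix n n ℂ)ᴴ = 1 := by
  rw [← Matrix.star_eq_conjTranspose]; exact Unitary.coe_mul_star_self V

/-- `Vᴴ ρ V`, the matrix `ρ` in the basis of the columns of `V`. -/
noncomputable def inBasis (V : Matrix.unitaryGroup n ℂ) (ρ : Matrix n n ℂ) : Matrix n n ℂ :=
  (V : Matrix n n ℂ)ᴴ * ρ * (V : Matrix n n ℂ)

theorem inBasis_mul (V : Matrix.unitaryGroup n ℂ) (ρ σ : Matrix n n ℂ) :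
    inBasis V (ρ * σ) = inBasis V ρ * inBasis V σ := by
  have : (V : Matrix n n ℂ) * ((V : Matrix n n ℂ)ᴴ * (σ * (V : Matrix n n ℂ)))
      = σ * (V : Matrix n n ℂ) := by
    rw [← mul_assoc, unitary_mul_conjTranspose, one_mul]
  simp only [inBasis, mul_assoc, this]

theorem inBasis_conjTranspose (V : Matrix.unitaryGroup n ℂ) (ρ : Matrix n n ℂ) :
    inBasis V ρᴴ = (inBasis V ρ)ᴴ := by
  simp [inBasis, mul_assoc]

theorem inBasis_conj (V : Matrix.unitaryGroup n ℂ) (ρ : Matrix n n ℂ) :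
    inBasis V ((V : Matrix n n ℂ) * ρ * (V : Matrix n n ℂ)ᴴ) = ρ := by
  simp only [inBasis, mul_assoc, unitary_conjTranspose_mul, mul_one]
  rw [← mul_assoc, unitary_conjTranspose_mul, one_mul]

theorem conj_inBasis (V : Matrix.unitaryGroup n ℂ) (ρ : Matrix n n ℂ) :
    (V : Matrix n n ℂ) * inBasis V ρ * (V : Matrix n n ℂ)ᴴ = ρ := by
  simp only [inBasis, mul_assoc, unitary_mul_conjTranspose, mul_one]
  rw [← mul_assoc, unitary_mul_conjTranspose, one_mul]

theorem inBasis_injective (V : Matrix.unitaryGroup n ℂ) : Function.Injective (inBasis V) :=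
  fun ρ σ h => by rw [← conj_inBasis V ρ, h, conj_inBasis]

theorem inBasis_add (V : Matrix.unitaryGroup n ℂ) (ρ σ : Matrix n n ℂ) :
    inBasis V (ρ + σ) = inBasis V ρ + inBasis V σ := by
  simp [inBasis, mul_add, add_mul]

theorem inBasis_smul (V : Matrix.unitaryGroup n ℂ) (c : ℂ) (ρ : Matrix n n ℂ) :
    inBasis V (c • ρ) = c • inBasis V ρ := by
  simp [inBasis]

theorem superop_ext_inBasis (V : Matrix.unitaryGroup n ℂ) {Φ Ψ : Superop n}
    (h : ∀ ρ, inBasis V (Φ ρ) = inBasis V (Ψ ρ)) : Φ = Ψ :=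
  ContinuousLinearMap.ext fun ρ => inBasis_injective V (h ρ)

/-- The superoperator multiplying the entries of `ρ`, in the basis of the columns of `V`, by the
coefficients `c`. -/
noncomputable def schurMap (V : Matrix.unitaryGroup n ℂ) (c : n × n → ℂ) : Superop n :=
  LinearMap.toContinuousLinearMap
    { toFun := fun ρ => (V : Matrix n n ℂ) * Matrix.of (fun i j => c (i, j) * inBasis V ρ i j)
        * (V : Matrix n n ℂ)ᴴ
      map_add' := fun ρ σ => by
        rw [← add_mul, ← mul_add]
        congr 2
        ext i j
        simp [inBasis_add, mul_add]
      map_smul' := fun a ρ => by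
        rw [RingHom.id_apply, ← smul_mul_assoc, ← mul_smul_comm]
        congr 2
        ext i j
        simp [inBasis_smul]
        ring }

theorem inBasis_schurMap (V : Matrix.unitaryGroup n ℂ) (c : n × n → ℂ) (ρ : Matrix n n ℂ)
    (i j : n) : inBasis V (schurMap V c ρ) i j = c (i, j) * inBasis V ρ i j := by
  change inBasis V ((V : Matrix n n ℂ) * Matrix.of (fun i j => c (i, j) * inBasis V ρ i j)
        * (V : Matrix n n ℂ)ᴴ) i j = _
  rw [inBasis_conj]
  rfl

/-- `schurMap` as a homomorphism of algebras. -/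
noncomputable def schurHom (V : Matrix.unitaryGroup n ℂ) : (n × n → ℂ) →ₐ[ℂ] Superop n :=
  AlgHom.ofLinearMap
    { toFun := schurMap V
      map_add' := fun c d => superop_ext_inBasis V fun ρ => by
        ext i j
        rw [add_apply, inBasis_add, Matrix.add_apply]
        simp only [inBasis_schurMap, Pi.add_apply, add_mul]
      map_smul' := fun a c => superop_ext_inBasis V fun ρ => by
        ext i j
        rw [RingHom.id_apply, smul_apply, inBasis_smul, Matrix.smul_apply]
        simp only [inBasis_schurMap, Pi.smul_apply, smul_eq_mul, mul_assoc] }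
    (superop_ext_inBasis V fun ρ => by
        ext i j
        change inBasis V (schurMap V 1 ρ) i j = _
        rw [inBasis_schurMap, Pi.one_apply, one_mul]
        rfl)
    (fun c d => superop_ext_inBasis V fun ρ => by
        ext i j
        change inBasis V (schurMap V (c * d) ρ) i j = inBasis V (schurMap V c (schurMap V d ρ)) i j
        simp only [inBasis_schurMap, Pi.mul_apply, mul_assoc])

theorem inBasis_schurHom (V : Matrix.unitaryGroup n ℂ) (c : n × n → ℂ) (ρ : Matrix n n ℂ)
    (i j : n) : inBasis V (schurHom V c ρ) i j = c (i, j) * inBasis V ρ i j :=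
  inBasis_schurMap V c ρ i j

theorem schurHom_injective (V : Matrix.unitaryGroup n ℂ) : Function.Injective (schurHom V) := by
  intro c d h
  funext p
  -- The test matrix has all entries 1 in the basis `V`, so its image displays the coefficients
  -- themselves.
  have := inBasis_schurHom V c ((V : Matrix n n ℂ) * Matrix.of (fun _ _ => 1)
    * (V : Matrix n n ℂ)ᴴ) p.1 p.2
  rw [h, inBasis_schurHom, inBasis_conj] at this
  simpa using this.symm

theorem schurHom_continuous (V : Matrix.unitaryGroup n ℂ) : Continuous (schurHom V) :=
  (schurHom V).toLinearMap.continuous_of_finiteDimensional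

theorem exp_schurHom (V : Matrix.unitaryGroup n ℂ) (c : n × n → ℂ) :
    NormedSpace.exp (schurHom V c) = schurHom V (fun p => Complex.exp (c p)) := by
  rw [← NormedSpace.map_exp (schurHom V) (schurHom_continuous V)]
  congr 1
  funext p
  rw [Pi.coe_exp, Complex.exp_eq_exp_ℂ]

theorem spectrum_schurHom (V : Matrix.unitaryGroup n ℂ) (c : n × n → ℂ) :
    spectrum ℂ (schurHom V c) = range c := by
  ext z
  constructor
  · intro hz
    by_contra hr
    apply spectrum.mem_iff.1 hz
    rw [← AlgHom.commutes (schurHom V), ← map_sub]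
    refine IsUnit.map (schurHom V) (Pi.isUnit_iff.2 fun p => ?_)
    rw [isUnit_iff_ne_zero]
    intro h
    exact hr ⟨p, (sub_eq_zero.1 h).symm⟩
  · rintro ⟨p, rfl⟩
    rw [spectrum.mem_iff]
    intro hu
    rw [← AlgHom.commutes (schurHom V), ← map_sub] at hu
    -- The function `c p - c` vanishes at `p`, so it annihilates the indicator of `p`, which has
    -- nonzero image; a unit cannot do this.
    have h0 : schurHom V (algebraMap ℂ (n × n → ℂ) (c p) - c) * schurHom V (Pi.single p 1) = 0 := by
      rw [← map_mul, ← map_zero (schurHom V)]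
      congr 1
      funext q
      by_cases hq : q = p
      · subst hq; simp
      · simp [hq]
    rw [hu.mul_right_eq_zero] at h0
    have := congrFun (schurHom_injective V (h0.trans (map_zero _).symm)) p
    simp at this

theorem inBasis_sandwich (V : Matrix.unitaryGroup n ℂ) (A B ρ : Matrix n n ℂ) :
    inBasis V (sandwich A B ρ) = inBasis V A * (inBasis V ρ * inBasis V B) := by
  rw [sandwich_apply, inBasis_mul, inBasis_mul]

theorem sandwich_conj_diagonal (V : Matrix.unitaryGroup n ℂ) (a b : n → ℂ) :
    sandwich ((V : Matrix n n ℂ) * Matrix.diagonal a * (V : Matrix n n ℂ)ᴴ)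
        ((V : Matrix n n ℂ) * Matrix.diagonal b * (V : Matrix n n ℂ)ᴴ)
      = schurHom V (fun p => a p.1 * b p.2) := by
  refine superop_ext_inBasis V fun ρ => ?_
  ext i j
  rw [inBasis_sandwich, inBasis_conj, inBasis_conj, inBasis_schurHom, Matrix.diagonal_mul,
    Matrix.mul_diagonal]
  ring

theorem unitary_conj_one (V : Matrix.unitaryGroup n ℂ) :
    (V : Matrix n n ℂ) * Matrix.diagonal (fun _ => 1) * (V : Matrix n n ℂ)ᴴ = 1 := by
  rw [Matrix.diagonal_one, mul_one, unitary_mul_conjTranspose]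

end SchurMultipliers

/-! ### Spectral decomposition of the free generator -/

section SpectralProjections

variable {n : Type*} [Fintype n] [DecidableEq n] {H : Matrix n n ℂ}

theorem eq_conj_diagonal (hH : H.IsHermitian) : H =
    (hH.eigenvectorUnitary : Matrix n n ℂ) * Matrix.diagonal (fun i => (hH.eigenvalues i : ℂ))
      * (hH.eigenvectorUnitary : Matrix n n ℂ)ᴴ := by
  have := hH.spectral_theorem
  rw [Unitary.conjStarAlgAut_apply] at this
  exact this

theorem freeGen_eq_schurHom (hH : H.IsHermitian) :
    freeGen H = schurHom hH.eigenvectorUnitary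
      (fun p => -Complex.I * ((hH.eigenvalues p.1 : ℂ) - hH.eigenvalues p.2)) := by
  have h1 : sandwich H 1 = schurHom hH.eigenvectorUnitary
      (fun p => (hH.eigenvalues p.1 : ℂ) * 1) := by
    rw [← sandwich_conj_diagonal hH.eigenvectorUnitary (fun i => (hH.eigenvalues i : ℂ))
      (fun _ => 1), unitary_conj_one, ← eq_conj_diagonal]
  have h2 : sandwich 1 H = schurHom hH.eigenvectorUnitary
      (fun p => 1 * (hH.eigenvalues p.2 : ℂ)) := by
    rw [← sandwich_conj_diagonal hH.eigenvectorUnitary (fun _ => 1)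
      (fun i => (hH.eigenvalues i : ℂ)), unitary_conj_one, ← eq_conj_diagonal]
  rw [freeGen, commSup, h1, h2, ← map_sub, ← map_smul]
  congr 1
  funext p
  simp

theorem eigenvalues_mem_energies (hH : H.IsHermitian) (i : n) : hH.eigenvalues i ∈ energies hH :=
  Finset.mem_image_of_mem _ (Finset.mem_univ i)

theorem mem_bohr (hH : H.IsHermitian) {ω : ℝ} :
    ω ∈ bohr hH ↔ ∃ p : n × n, hH.eigenvalues p.1 - hH.eigenvalues p.2 = ω := by
  simp [bohr, energies]

/-- At the entry `(i, j)` only the energy pair `(ε_i, ε_j)` contributes to the defining sum. -/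
theorem freqProj_eq_schurHom (hH : H.IsHermitian) (ω : ℝ) :
    freqProj hH ω = schurHom hH.eigenvectorUnitary
      (fun p => if hH.eigenvalues p.1 - hH.eigenvalues p.2 = ω then 1 else 0) := by
  have : ∀ p : ℝ × ℝ, (if p.1 - p.2 = ω then sandwich (eigProj hH p.1) (eigProj hH p.2) else 0)
      = schurHom hH.eigenvectorUnitary (fun q => if p.1 - p.2 = ω then
        (if hH.eigenvalues q.1 = p.1 then 1 else 0) * (if hH.eigenvalues q.2 = p.2 then 1 else 0)
        else 0) := by
    intro p
    split_ifs with h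
    · rw [eigProj, eigProj, sandwich_conj_diagonal]
    · exact (map_zero (schurHom hH.eigenvectorUnitary)).symm
  rw [freqProj, Finset.sum_congr rfl fun p _ => this p, ← map_sum]
  congr 1
  funext q
  rw [Finset.sum_apply, Finset.sum_eq_single (hH.eigenvalues q.1, hH.eigenvalues q.2)]
  · simp
  · intro p _ hp
    by_cases h1 : hH.eigenvalues q.1 = p.1
    · by_cases h2 : hH.eigenvalues q.2 = p.2
      · exact absurd (Prod.ext h1.symm h2.symm) hp
      · simp [h2]
    · simp [h1]
  · intro h
    exact absurd (Finset.mem_product.2 ⟨eigenvalues_mem_energies hH _,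
      eigenvalues_mem_energies hH _⟩) h

theorem inBasis_freqProj (hH : H.IsHermitian) (ω : ℝ) (ρ : Matrix n n ℂ) (i j : n) :
    inBasis hH.eigenvectorUnitary (freqProj hH ω ρ) i j =
      if hH.eigenvalues i - hH.eigenvalues j = ω
        then inBasis hH.eigenvectorUnitary ρ i j else 0 := by
  rw [freqProj_eq_schurHom, inBasis_schurHom]
  simp

theorem spectrum_freeGen (hH : H.IsHermitian) :
    spectrum ℂ (freeGen H) = (fun ω : ℝ => -Complex.I * ω) '' (bohr hH : Set ℝ) := by
  rw [freeGen_eq_schurHom hH, spectrum_schurHom]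
  ext z
  simp only [mem_range, mem_image, Finset.mem_coe, mem_bohr]
  constructor
  · rintro ⟨p, rfl⟩
    exact ⟨_, ⟨p, rfl⟩, by push_cast; rfl⟩
  · rintro ⟨_, ⟨p, rfl⟩, rfl⟩
    exact ⟨p, by push_cast; rfl⟩

/-- A function of the free generator through its spectral decomposition. -/
theorem sum_smul_freqProj (hH : H.IsHermitian) (f : ℝ → ℂ) :
    ∑ ω ∈ bohr hH, f ω • freqProj hH ω = schurHom hH.eigenvectorUnitary
      (fun p => f (hH.eigenvalues p.1 - hH.eigenvalues p.2)) := by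
  simp only [freqProj_eq_schurHom, ← map_smul]
  rw [← map_sum]
  congr 1
  funext p
  simp only [Finset.sum_apply, Pi.smul_apply, smul_eq_mul, mul_ite, mul_one, mul_zero]
  rw [Finset.sum_ite_eq, if_pos ((mem_bohr hH).2 ⟨p, rfl⟩)]

theorem freeGen_eq_sum (hH : H.IsHermitian) :
    freeGen H = (-Complex.I) • ∑ ω ∈ bohr hH, (ω : ℂ) • freqProj hH ω := by
  rw [sum_smul_freqProj hH (fun ω => (ω : ℂ)), freeGen_eq_schurHom hH, ← map_smul]
  congr 1
  funext p
  simp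

theorem sum_freqProj (hH : H.IsHermitian) : ∑ ω ∈ bohr hH, freqProj hH ω = 1 := by
  have := sum_smul_freqProj hH (fun _ => 1)
  simp only [one_smul] at this
  rw [this]
  exact map_one (schurHom hH.eigenvectorUnitary)

theorem freqProj_mul_freqProj (hH : H.IsHermitian) (ω ω' : ℝ) :
    freqProj hH ω * freqProj hH ω' = if ω = ω' then freqProj hH ω else 0 := by
  have : (if ω = ω' then freqProj hH ω else 0) = schurHom hH.eigenvectorUnitary (fun p =>
      if ω = ω' then (if hH.eigenvalues p.1 - hH.eigenvalues p.2 = ω then 1 else 0) else 0) := by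
    split_ifs
    · exact freqProj_eq_schurHom hH ω
    · exact (map_zero (schurHom hH.eigenvectorUnitary)).symm
  rw [this, freqProj_eq_schurHom, freqProj_eq_schurHom, ← map_mul]
  congr 1
  funext p
  simp only [Pi.mul_apply, mul_ite, mul_one, mul_zero]
  grind

theorem exp_smul_freeGen (hH : H.IsHermitian) (z : ℂ) :
    NormedSpace.exp (z • freeGen H)
      = ∑ ω ∈ bohr hH, Complex.exp (-Complex.I * ω * z) • freqProj hH ω := by
  rw [sum_smul_freqProj hH (fun ω => Complex.exp (-Complex.I * ω * z)), freeGen_eq_schurHom hH,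
    ← map_smul, exp_schurHom]
  congr 1
  funext p
  congr 1
  simp only [Pi.smul_apply, smul_eq_mul, Complex.ofReal_sub]
  ring

/-- The free evolution is `ρ ↦ U ρ Uᴴ` for a unitary `U`. -/
theorem exists_unitary_exp_freeGen (hH : H.IsHermitian) (t : ℝ) :
    ∃ U : Matrix n n ℂ, Uᴴ * U = 1 ∧
      NormedSpace.exp ((t : ℂ) • freeGen H) = sandwich U Uᴴ := by
  set V := hH.eigenvectorUnitary with hV
  -- These are the eigenvalues of `e^{-itH}`, which serves as `U`.
  let d : n → ℂ := fun i => Complex.exp (-(t * hH.eigenvalues i : ℝ) * Complex.I)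
  have hd : ∀ i, star (d i) = Complex.exp ((t * hH.eigenvalues i : ℝ) * Complex.I) := by
    intro i
    simp only [d, Complex.star_def, ← Complex.exp_conj, map_mul, map_neg, Complex.conj_ofReal,
      Complex.conj_I]
    congr 1
    ring
  have hU : ((V : Matrix n n ℂ) * Matrix.diagonal d * (V : Matrix n n ℂ)ᴴ)ᴴ
      = (V : Matrix n n ℂ) * Matrix.diagonal (star d) * (V : Matrix n n ℂ)ᴴ := by
    simp only [Matrix.conjTranspose_mul, Matrix.conjTranspose_conjTranspose,
      Matrix.diagonal_conjTranspose, mul_assoc]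
  refine ⟨(V : Matrix n n ℂ) * Matrix.diagonal d * (V : Matrix n n ℂ)ᴴ, ?_, ?_⟩
  · rw [hU]
    have : (V : Matrix n n ℂ)ᴴ * ((V : Matrix n n ℂ) * (Matrix.diagonal d * (V : Matrix n n ℂ)ᴴ))
        = Matrix.diagonal d * (V : Matrix n n ℂ)ᴴ := by
      rw [← mul_assoc, unitary_conjTranspose_mul, one_mul]
    rw [mul_assoc, mul_assoc, mul_assoc, this, ← mul_assoc (Matrix.diagonal _),
      Matrix.diagonal_mul_diagonal, ← mul_assoc]
    have hone : (fun i => star d i * d i) = fun _ => 1 := by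
      funext i
      rw [Pi.star_apply, hd, ← Complex.exp_add]
      simp
    rw [hone, unitary_conj_one]
  · rw [hU, sandwich_conj_diagonal, freeGen_eq_schurHom hH, ← map_smul, exp_schurHom]
    congr 1
    funext p
    rw [Pi.star_apply, hd, ← Complex.exp_add]
    congr 1
    simp only [Pi.smul_apply, smul_eq_mul]
    push_cast
    ring

end SpectralProjections

/-! ### Time averages, the commutator equation and the error bound -/

section Averaging

variable {n : Type*} [Fintype n] [DecidableEq n] {H : Matrix n n ℂ}

/-- For `c ≠ 0` the oscillating integral stays below `2 / |c|`, so division by `τ` sends it to 0. -/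
theorem tendsto_average_exp (c : ℝ) :
    Tendsto (fun τ : ℝ => ((τ⁻¹ : ℝ) : ℂ) * ∫ s in (0 : ℝ)..τ, Complex.exp (Complex.I * c * s))
      atTop (𝓝 (if c = 0 then 1 else 0)) := by
  split_ifs with hc
  · subst hc
    refine tendsto_const_nhds.congr' ?_
    filter_upwards [eventually_gt_atTop 0] with τ hτ
    have : (τ : ℂ) ≠ 0 := Complex.ofReal_ne_zero.2 hτ.ne'
    simp [this]
  · have hc' : Complex.I * (c : ℂ) ≠ 0 := mul_ne_zero Complex.I_ne_zero (Complex.ofReal_ne_zero.2 hc)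
    refine squeeze_zero_norm' (a := fun τ : ℝ => τ⁻¹ * (2 / |c|)) ?_ ?_
    · filter_upwards [eventually_gt_atTop 0] with τ hτ
      rw [norm_mul, Complex.norm_real, Real.norm_of_nonneg (inv_pos.2 hτ).le]
      refine mul_le_mul_of_nonneg_left ?_ (inv_pos.2 hτ).le
      rw [integral_exp_mul_complex hc', norm_div, norm_mul, Complex.norm_I, one_mul,
        Complex.norm_real, Real.norm_eq_abs]
      refine div_le_div_of_nonneg_right ((norm_sub_le _ _).trans ?_) (abs_nonneg c)
      have : ∀ x : ℝ, ‖Complex.exp (Complex.I * c * x)‖ = 1 := by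
        intro x
        have e : Complex.I * c * x = ((c * x : ℝ) : ℂ) * Complex.I := by push_cast; ring
        rw [e, Complex.norm_exp_ofReal_mul_I]
      rw [this, this]
      norm_num
    · simpa using tendsto_inv_atTop_zero.mul_const (2 / |c|)

theorem zenoAverage_eq_sum_ite (hH : H.IsHermitian) (D : Superop n) :
    zenoAverage hH D = ∑ ω ∈ bohr hH, ∑ ω' ∈ bohr hH,
      (if ω - ω' = 0 then (1 : ℂ) else 0) • (freqProj hH ω * D * freqProj hH ω') := by
  rw [zenoAverage]
  refine Finset.sum_congr rfl fun ω hω => ?_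
  simp only [sub_eq_zero, ite_smul, one_smul, zero_smul]
  rw [Finset.sum_ite_eq, if_pos hω]

theorem exp_conj_freeGen (hH : H.IsHermitian) (D : Superop n) (s : ℝ) :
    NormedSpace.exp (-(s : ℂ) • freeGen H) * D * NormedSpace.exp ((s : ℂ) • freeGen H)
      = ∑ ω ∈ bohr hH, ∑ ω' ∈ bohr hH,
        Complex.exp (Complex.I * (ω - ω' : ℝ) * s) • (freqProj hH ω * D * freqProj hH ω') := by
  rw [exp_smul_freeGen hH, exp_smul_freeGen hH, Finset.sum_mul, Finset.sum_mul]
  refine Finset.sum_congr rfl fun ω _ => ?_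
  rw [Finset.mul_sum]
  refine Finset.sum_congr rfl fun ω' _ => ?_
  rw [smul_mul_assoc, smul_mul_smul_comm, ← Complex.exp_add]
  congr 2
  push_cast
  ring

/-- The long-time average of the freely evolved superoperator `D`. -/
theorem tendsto_zenoAverage (hH : H.IsHermitian) (D : Superop n) :
    Tendsto (fun τ : ℝ => ((τ⁻¹ : ℝ) : ℂ) • ∫ s in (0 : ℝ)..τ,
        NormedSpace.exp (-(s : ℂ) • freeGen H) * D * NormedSpace.exp ((s : ℂ) • freeGen H))
      atTop (𝓝 (zenoAverage hH D)) := by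
  have hint : ∀ τ : ℝ, ((τ⁻¹ : ℝ) : ℂ) • ∫ s in (0 : ℝ)..τ,
        NormedSpace.exp (-(s : ℂ) • freeGen H) * D * NormedSpace.exp ((s : ℂ) • freeGen H)
      = ∑ ω ∈ bohr hH, ∑ ω' ∈ bohr hH, (((τ⁻¹ : ℝ) : ℂ) * ∫ s in (0 : ℝ)..τ,
        Complex.exp (Complex.I * (ω - ω' : ℝ) * s)) • (freqProj hH ω * D * freqProj hH ω') := by
    intro τ
    have hi : ∀ ω ω' : ℝ, IntervalIntegrable (fun s : ℝ =>
        Complex.exp (Complex.I * (ω - ω' : ℝ) * s) • (freqProj hH ω * D * freqProj hH ω'))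
        volume 0 τ := by
      intro ω ω'
      exact Continuous.intervalIntegrable (by fun_prop) _ _
    simp_rw [exp_conj_freeGen hH D]
    rw [intervalIntegral.integral_finsetSum fun ω _ =>
      Continuous.intervalIntegrable (by fun_prop) _ _, Finset.smul_sum]
    refine Finset.sum_congr rfl fun ω _ => ?_
    rw [intervalIntegral.integral_finsetSum fun ω' _ => hi ω ω', Finset.smul_sum]
    refine Finset.sum_congr rfl fun ω' _ => ?_
    rw [intervalIntegral.integral_smul_const, smul_smul]
  simp_rw [hint]
  rw [zenoAverage_eq_sum_ite]
  exact tendsto_finsetSum _ fun ω _ => tendsto_finsetSum _ fun ω' _ =>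
    (tendsto_average_exp (ω - ω')).smul_const _

theorem freqProj_mul_freeGen (hH : H.IsHermitian) (ω : ℝ) :
    freqProj hH ω * freeGen H = (-Complex.I * ω) • freqProj hH ω := by
  rw [freqProj_eq_schurHom, freeGen_eq_schurHom hH, ← map_mul, ← map_smul]
  congr 1
  funext p
  simp only [Pi.mul_apply, Pi.smul_apply, smul_eq_mul]
  split_ifs with h
  · rw [← h]; push_cast; ring
  · ring

theorem freeGen_mul_freqProj (hH : H.IsHermitian) (ω : ℝ) :
    freeGen H * freqProj hH ω = (-Complex.I * ω) • freqProj hH ω := by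
  rw [← freqProj_mul_freeGen, freqProj_eq_schurHom, freeGen_eq_schurHom hH, ← map_mul, ← map_mul,
    mul_comm]

/-- The solution `G` of `[G, κ 𝓛₀] = D - D_Z`. -/
noncomputable def zenoCorrector (hH : H.IsHermitian) (D : Superop n) (κ : ℝ) : Superop n :=
  ∑ p ∈ (bohr hH).offDiag, (Complex.I * κ * (p.1 - p.2 : ℝ))⁻¹ •
    (freqProj hH p.1 * D * freqProj hH p.2)

theorem zenoCorrector_comm (hH : H.IsHermitian) (D : Superop n) {κ : ℝ} (hκ : 0 < κ) :
    zenoCorrector hH D κ * ((κ : ℂ) • freeGen H) - ((κ : ℂ) • freeGen H) * zenoCorrector hH D κ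
      = D - zenoAverage hH D := by
  have hD : D = ∑ p ∈ bohr hH ×ˢ bohr hH, freqProj hH p.1 * D * freqProj hH p.2 := by
    rw [Finset.sum_product]
    simp_rw [← Finset.mul_sum, sum_freqProj, mul_one, ← Finset.sum_mul, sum_freqProj, one_mul]
  have hsplit : D - zenoAverage hH D
      = ∑ p ∈ (bohr hH).offDiag, freqProj hH p.1 * D * freqProj hH p.2 := by
    rw [sub_eq_iff_eq_add]
    conv_lhs => rw [hD, ← Finset.diag_union_offDiag,
      Finset.sum_union (Finset.disjoint_diag_offDiag _), Finset.sum_diag]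
    rw [add_comm]
    rfl
  rw [hsplit, zenoCorrector, Finset.sum_mul, Finset.mul_sum, ← Finset.sum_sub_distrib]
  refine Finset.sum_congr rfl fun p hp => ?_
  have hne : ((p.1 - p.2 : ℝ) : ℂ) ≠ 0 :=
    Complex.ofReal_ne_zero.2 (sub_ne_zero.2 (Finset.mem_offDiag.1 hp).2.2)
  have hκ' : (κ : ℂ) ≠ 0 := Complex.ofReal_ne_zero.2 hκ.ne'
  -- The block `(ω, ω')` is an eigenvector of `[·, κ𝓛₀]` with eigenvalue `iκ(ω - ω')`, the inverse
  -- of its coefficient in `zenoCorrector`.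
  have h1 : freqProj hH p.1 * D * freqProj hH p.2 * freeGen H
      = (-Complex.I * p.2) • (freqProj hH p.1 * D * freqProj hH p.2) := by
    rw [mul_assoc, freqProj_mul_freeGen, mul_smul_comm]
  have h2 : freeGen H * (freqProj hH p.1 * D * freqProj hH p.2)
      = (-Complex.I * p.1) • (freqProj hH p.1 * D * freqProj hH p.2) := by
    rw [← mul_assoc, ← mul_assoc, freeGen_mul_freqProj, smul_mul_assoc, smul_mul_assoc]
  rw [smul_mul_smul_comm, smul_mul_smul_comm, h1, h2, smul_smul, smul_smul]
  refine (sub_smul _ _ _).symm.trans ?_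
  conv_rhs => rw [← one_smul ℂ (freqProj hH p.1 * D * freqProj hH p.2)]
  congr 1
  push_cast at hne ⊢
  field_simp
  ring

theorem gap_le (hH : H.IsHermitian) {ω ω' : ℝ} (hω : ω ∈ bohr hH) (hω' : ω' ∈ bohr hH)
    (hne : ω ≠ ω') : gap hH ≤ |ω - ω'| :=
  csInf_le ⟨0, by rintro _ ⟨_, _, _, _, _, rfl⟩; exact abs_nonneg _⟩ ⟨ω, hω, ω', hω', hne, rfl⟩

/-- The set of differences is finite, so the infimum is attained; two distinct frequencies are
needed, as the infimum of the empty set is 0 by convention. -/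
theorem gap_pos (hH : H.IsHermitian) {ω ω' : ℝ} (hω : ω ∈ bohr hH) (hω' : ω' ∈ bohr hH)
    (hne : ω ≠ ω') : 0 < gap hH := by
  have hfin : {x : ℝ | ∃ ω ∈ bohr hH, ∃ ω' ∈ bohr hH, ω ≠ ω' ∧ x = |ω - ω'|}.Finite := by
    refine (((bohr hH) ×ˢ (bohr hH)).image fun p => |p.1 - p.2|).finite_toSet.subset ?_
    rintro _ ⟨a, ha, b, hb, _, rfl⟩
    exact Finset.mem_coe.2 (Finset.mem_image.2 ⟨(a, b), Finset.mem_product.2 ⟨ha, hb⟩, rfl⟩)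
  obtain ⟨a, _, b, _, hab, h⟩ := Set.Nonempty.csInf_mem
    (s := {x : ℝ | ∃ ω ∈ bohr hH, ∃ ω' ∈ bohr hH, ω ≠ ω' ∧ x = |ω - ω'|})
    ⟨_, ω, hω, ω', hω', hne, rfl⟩ hfin
  rw [gap, h]
  exact abs_pos.2 (sub_ne_zero.2 hab)

theorem le_maxProjNorm (hH : H.IsHermitian) (N : Superop n → ℝ) {ω : ℝ} (hω : ω ∈ bohr hH) :
    N (freqProj hH ω) ≤ maxProjNorm hH N :=
  le_csSup ((bohr hH).finite_toSet.image _).bddAbove ⟨ω, hω, rfl⟩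

/-- There are `m(m-1)` off-diagonal blocks, each costing at most `P² N D / (κΔ)`. For `m ≤ 1` both
sides vanish. -/
theorem algebraNorm_zenoCorrector_le (hH : H.IsHermitian) (D : Superop n)
    (N : AlgebraNorm ℂ (Superop n)) {κ : ℝ} (hκ : 0 < κ) :
    N (zenoCorrector hH D κ)
      ≤ (bohr hH).card * ((bohr hH).card - 1) * maxProjNorm hH N ^ 2 * N D / (κ * gap hH) := by
  have hterm : ∀ p ∈ (bohr hH).offDiag, N ((Complex.I * κ * (p.1 - p.2 : ℝ))⁻¹ •
      (freqProj hH p.1 * D * freqProj hH p.2)) ≤ maxProjNorm hH N ^ 2 * N D / (κ * gap hH) := by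
    intro p hp
    obtain ⟨h1, h2, hne⟩ := Finset.mem_offDiag.1 hp
    have hg := gap_pos hH h1 h2 hne
    have hP1 := le_maxProjNorm hH N h1
    have hP2 := le_maxProjNorm hH N h2
    have hP0 : 0 ≤ maxProjNorm hH N := (apply_nonneg N _).trans hP1
    have hm : N (freqProj hH p.1 * D * freqProj hH p.2) ≤ maxProjNorm hH N ^ 2 * N D := by
      calc _ ≤ N (freqProj hH p.1) * N D * N (freqProj hH p.2) :=
            (map_mul_le_mul N _ _).trans
              (mul_le_mul_of_nonneg_right (map_mul_le_mul N _ _) (apply_nonneg N _))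
        _ ≤ maxProjNorm hH N * N D * maxProjNorm hH N := by
            have := apply_nonneg N D
            have := apply_nonneg N (freqProj hH p.2)
            gcongr
        _ = _ := by ring
    rw [map_smul_eq_mul, norm_inv, norm_mul, norm_mul, Complex.norm_I, one_mul, Complex.norm_real,
      Complex.norm_real, Real.norm_of_nonneg hκ.le, Real.norm_eq_abs, div_eq_inv_mul]
    refine mul_le_mul ?_ hm (apply_nonneg N _) (by positivity)
    exact inv_anti₀ (by positivity) (mul_le_mul_of_nonneg_left (gap_le hH h1 h2 hne) hκ.le)
  have hsum : N (zenoCorrector hH D κ) ≤ ∑ p ∈ (bohr hH).offDiag,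
      N ((Complex.I * κ * (p.1 - p.2 : ℝ))⁻¹ • (freqProj hH p.1 * D * freqProj hH p.2)) :=
    Finset.le_sum_of_subadditive N (map_zero N).le (map_add_le_add N) _ _
  refine (hsum.trans (Finset.sum_le_card_nsmul _ _ _ hterm)).trans_eq ?_
  rw [nsmul_eq_mul, Finset.offDiag_card, Nat.cast_sub (Nat.le_mul_self _)]
  push_cast
  ring

/-- The error of the averaged generator in a norm in which the free evolution is contractive. -/
theorem algebraNorm_exp_sub_exp_zenoAverage_le (hH : H.IsHermitian) (D : Superop n)
    (N : AlgebraNorm ℂ (Superop n))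
    (hN : ∀ t : ℝ, 0 ≤ t → N (NormedSpace.exp ((t : ℂ) • freeGen H)) ≤ 1)
    {κ T t : ℝ} (hκ : 0 < κ) (ht : 0 ≤ t) (htT : t ≤ T) :
    N (NormedSpace.exp ((t : ℂ) • ((κ : ℂ) • freeGen H + D))
        - NormedSpace.exp ((t : ℂ) • ((κ : ℂ) • freeGen H + zenoAverage hH D)))
      ≤ errorBound hH D N κ T := by
  have hA : ∀ t : ℝ, 0 ≤ t → N (NormedSpace.exp ((t : ℂ) • ((κ : ℂ) • freeGen H))) ≤ 1 := by
    intro s hs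
    have := hN (s * κ) (by positivity)
    rwa [Complex.ofReal_mul, mul_smul] at this
  have h1 := algebraNorm_exp_sub_exp_le N (continuous_algebraNorm N) hA
    (zenoCorrector_comm hH D hκ) ht htT
  have h2 := algebraNorm_zenoCorrector_le hH D N hκ
  have hD := apply_nonneg N D
  have hZ := apply_nonneg N (zenoAverage hH D)
  have hT := ht.trans htT
  refine h1.trans ((mul_le_mul_of_nonneg_right
    (mul_le_mul_of_nonneg_left h2 zero_le_two) (by positivity)).trans_eq ?_)
  rw [errorBound]
  ring

end Averaging

/-! ### Algebra of left and right multiplications -/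

section Sandwich

variable {n : Type*} [Fintype n] [DecidableEq n]

theorem sandwich_mul_sandwich (A B A' B' : Matrix n n ℂ) :
    sandwich A B * sandwich A' B' = sandwich (A * A') (B' * B) := by
  refine ContinuousLinearMap.ext fun ρ => ?_
  change A * ((A' * (ρ * B')) * B) = A * A' * (ρ * (B' * B))
  simp only [mul_assoc]

theorem sandwich_sum_left {ι : Type*} (s : Finset ι) (A : ι → Matrix n n ℂ) (B : Matrix n n ℂ) :
    sandwich (∑ i ∈ s, A i) B = ∑ i ∈ s, sandwich (A i) B := by
  refine ContinuousLinearMap.ext fun ρ => ?_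
  simp only [sum_apply, sandwich_apply, Finset.sum_mul]

theorem sandwich_sum_right {ι : Type*} (s : Finset ι) (A : Matrix n n ℂ) (B : ι → Matrix n n ℂ) :
    sandwich A (∑ i ∈ s, B i) = ∑ i ∈ s, sandwich A (B i) := by
  refine ContinuousLinearMap.ext fun ρ => ?_
  simp only [sum_apply, sandwich_apply, Finset.mul_sum]

theorem sandwich_smul_left (c : ℂ) (A B : Matrix n n ℂ) :
    sandwich (c • A) B = c • sandwich A B := by
  refine ContinuousLinearMap.ext fun ρ => ?_
  simp only [smul_apply, sandwich_apply, smul_mul_assoc]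

theorem sandwich_smul_right (c : ℂ) (A B : Matrix n n ℂ) :
    sandwich A (c • B) = c • sandwich A B := by
  refine ContinuousLinearMap.ext fun ρ => ?_
  simp only [smul_apply, sandwich_apply, mul_smul_comm]

theorem commSup_sum {ι : Type*} (s : Finset ι) (A : ι → Matrix n n ℂ) :
    commSup (∑ i ∈ s, A i) = ∑ i ∈ s, commSup (A i) := by
  simp only [commSup, sandwich_sum_left, sandwich_sum_right, Finset.sum_sub_distrib]

theorem commSup_smul (c : ℂ) (A : Matrix n n ℂ) : commSup (c • A) = c • commSup A := by
  rw [commSup, commSup, sandwich_smul_left, sandwich_smul_right, smul_sub]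

theorem commSup_add (A B : Matrix n n ℂ) : commSup (A + B) = commSup A + commSup B := by
  refine ContinuousLinearMap.ext fun ρ => ?_
  change (A + B) * (ρ * 1) - 1 * (ρ * (A + B)) =
    (A * (ρ * 1) - 1 * (ρ * A)) + (B * (ρ * 1) - 1 * (ρ * B))
  noncomm_ring

end Sandwich

/-! ### Averages of left and right multiplications -/

section ZenoAverage

variable {n : Type*} [Fintype n] [DecidableEq n] {H : Matrix n n ℂ}

/-- `zenoAverage` as a linear map. -/
noncomputable def zenoAverageLin (hH : H.IsHermitian) : Superop n →ₗ[ℂ] Superop n where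
  toFun := zenoAverage hH
  map_add' D D' := by
    simp only [zenoAverage, mul_add, add_mul, Finset.sum_add_distrib]
  map_smul' c D := by
    simp only [zenoAverage, mul_smul_comm, smul_mul_assoc, Finset.smul_sum, RingHom.id_apply]

theorem inBasis_sum {ι : Type*} (V : Matrix.unitaryGroup n ℂ) (s : Finset ι)
    (A : ι → Matrix n n ℂ) : inBasis V (∑ i ∈ s, A i) = ∑ i ∈ s, inBasis V (A i) := by
  simp only [inBasis, Finset.mul_sum, Finset.sum_mul]

theorem inBasis_one (V : Matrix.unitaryGroup n ℂ) : inBasis V 1 = 1 := by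
  rw [inBasis, mul_one, unitary_conjTranspose_mul]

theorem inBasis_zenoAverage (hH : H.IsHermitian) (D : Superop n) (ρ : Matrix n n ℂ) (i j : n) :
    inBasis hH.eigenvectorUnitary (zenoAverage hH D ρ) i j
      = inBasis hH.eigenvectorUnitary
        (D (freqProj hH (hH.eigenvalues i - hH.eigenvalues j) ρ)) i j := by
  have h : zenoAverage hH D ρ = ∑ ω ∈ bohr hH, freqProj hH ω (D (freqProj hH ω ρ)) := by
    simp only [zenoAverage, sum_apply]
    rfl
  rw [h, inBasis_sum, Matrix.sum_apply]
  simp only [inBasis_freqProj]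
  rw [Finset.sum_ite_eq, if_pos ((mem_bohr hH).2 ⟨(i, j), rfl⟩)]

/-- The term `A_{ik} ρ_{kl} B_{lj}` survives when `ε_k - ε_l = ε_i - ε_j`, that is, when `ε_i - ε_k
= ε_j - ε_l`: the frequency of `A_{ik}` must equal that of `(Bᴴ)_{jl}`. -/
theorem zenoAverage_sandwich (hH : H.IsHermitian) (A B : Matrix n n ℂ) :
    zenoAverage hH (sandwich A B)
      = ∑ ω ∈ bohr hH, sandwich (freqProj hH ω A) (freqProj hH ω Bᴴ)ᴴ := by
  refine superop_ext_inBasis hH.eigenvectorUnitary fun ρ => ?_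
  ext i j
  rw [inBasis_zenoAverage, inBasis_sandwich, sum_apply, inBasis_sum, Matrix.sum_apply]
  simp only [inBasis_sandwich, Matrix.mul_apply, inBasis_conjTranspose, inBasis_freqProj,
    Matrix.conjTranspose_apply, Finset.mul_sum]
  conv_rhs => rw [Finset.sum_comm]
  refine Finset.sum_congr rfl fun k _ => ?_
  conv_rhs => rw [Finset.sum_comm]
  refine Finset.sum_congr rfl fun l _ => ?_
  simp only [ite_mul, zero_mul]
  rw [Finset.sum_ite_eq, if_pos ((mem_bohr hH).2 ⟨(i, k), rfl⟩)]
  by_cases h : hH.eigenvalues j - hH.eigenvalues l = hH.eigenvalues i - hH.eigenvalues k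
  · rw [if_pos h, if_pos (by linarith), star_star]
  · rw [if_neg h, if_neg fun h' => h (by linarith), star_zero]
    simp

theorem zenoAverage_sandwich_one_right (hH : H.IsHermitian) (A : Matrix n n ℂ) :
    zenoAverage hH (sandwich A 1) = sandwich (freqProj hH 0 A) 1 := by
  refine superop_ext_inBasis hH.eigenvectorUnitary fun ρ => ?_
  ext i j
  rw [inBasis_zenoAverage, inBasis_sandwich, inBasis_sandwich, inBasis_one, mul_one, mul_one]
  simp only [Matrix.mul_apply, inBasis_freqProj]
  refine Finset.sum_congr rfl fun k _ => ?_
  grind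

theorem zenoAverage_sandwich_one_left (hH : H.IsHermitian) (A : Matrix n n ℂ) :
    zenoAverage hH (sandwich 1 A) = sandwich 1 (freqProj hH 0 A) := by
  refine superop_ext_inBasis hH.eigenvectorUnitary fun ρ => ?_
  ext i j
  rw [inBasis_zenoAverage, inBasis_sandwich, inBasis_sandwich, inBasis_one, one_mul, one_mul]
  simp only [Matrix.mul_apply, inBasis_freqProj]
  refine Finset.sum_congr rfl fun k _ => ?_
  grind

/-- If `ε_i = ε_j`, the factors of `A_{ik} B_{kj}` have opposite frequencies, so `Aᴴ` and `B`
contribute at the same `ω = ε_k - ε_j`. -/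
theorem freqProj_zero_mul (hH : H.IsHermitian) (A B : Matrix n n ℂ) :
    freqProj hH 0 (A * B) = ∑ ω ∈ bohr hH, (freqProj hH ω Aᴴ)ᴴ * freqProj hH ω B := by
  refine inBasis_injective hH.eigenvectorUnitary ?_
  ext i j
  rw [inBasis_freqProj, inBasis_sum, Matrix.sum_apply]
  simp only [inBasis_mul, Matrix.mul_apply, inBasis_conjTranspose, inBasis_freqProj,
    Matrix.conjTranspose_apply]
  rw [Finset.sum_comm]
  simp only [mul_ite, mul_zero]
  have hk : ∀ k, hH.eigenvalues k - hH.eigenvalues j ∈ bohr hH :=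
    fun k => (mem_bohr hH).2 ⟨(k, j), rfl⟩
  simp only [Finset.sum_ite_eq, hk, if_true]
  by_cases h : hH.eigenvalues i - hH.eigenvalues j = 0
  · rw [if_pos h]
    refine Finset.sum_congr rfl fun k _ => ?_
    rw [if_pos (by linarith), star_star]
  · rw [if_neg h]
    refine (Finset.sum_eq_zero fun k _ => ?_).symm
    rw [if_neg fun h' => h (by linarith), star_zero, zero_mul]

end ZenoAverage

/-! ### The Redfield dissipator averages to the secular one -/

section Redfield

variable {n ι : Type*} [Fintype n] [DecidableEq n] [Fintype ι] {H : Matrix n n ℂ}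

theorem integrableOn_mul_exp {c : ℝ → ℂ} (hc : IntegrableOn c (Ioi 0)) (ω : ℝ) :
    IntegrableOn (fun τ : ℝ => c τ * Complex.exp (-Complex.I * ω * τ)) (Ioi 0) := by
  refine Integrable.mul_bdd (c := 1) hc (Continuous.aestronglyMeasurable (by fun_prop))
    (Eventually.of_forall fun τ => ?_)
  have e : -Complex.I * ω * τ = ((-(ω * τ) : ℝ) : ℂ) * Complex.I := by push_cast; ring
  rw [e, Complex.norm_exp_ofReal_mul_I]

/-- On each frequency component the free evolution is a scalar phase, so the operator integral
collapses to the scalars `Γ_{αβ}(ω)`. -/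
theorem bathOp_eq_sum (hH : H.IsHermitian) (S : ι → Matrix n n ℂ) {C : ι → ι → ℝ → ℂ}
    (hC : ∀ α β, IntegrableOn (C α β) (Ioi (0 : ℝ))) (α : ι) :
    bathOp H S C α = ∑ β, ∑ ω ∈ bohr hH, bathGamma C ω α β • freqProj hH ω (S β) := by
  rw [bathOp]
  refine Finset.sum_congr rfl fun β _ => ?_
  have : ∀ τ : ℝ, C α β τ • (NormedSpace.exp ((τ : ℂ) • freeGen H)) (S β)
      = ∑ ω ∈ bohr hH, (C α β τ * Complex.exp (-Complex.I * ω * τ)) • freqProj hH ω (S β) := by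
    intro τ
    rw [exp_smul_freeGen hH, sum_apply, Finset.smul_sum]
    simp only [smul_apply, smul_smul]
  simp_rw [this]
  rw [integral_finsetSum _ fun ω _ => (integrableOn_mul_exp (hC α β) ω).smul_const _]
  refine Finset.sum_congr rfl fun ω _ => ?_
  rw [integral_smul_const, bathGamma]

theorem freqProj_bathOp (hH : H.IsHermitian) (S : ι → Matrix n n ℂ) {C : ι → ι → ℝ → ℂ}
    (hC : ∀ α β, IntegrableOn (C α β) (Ioi (0 : ℝ))) (α : ι) {ω : ℝ} (hω : ω ∈ bohr hH) :
    freqProj hH ω (bathOp H S C α) = ∑ β, bathGamma C ω α β • freqProj hH ω (S β) := by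
  rw [bathOp_eq_sum hH S hC, map_sum]
  refine Finset.sum_congr rfl fun β _ => ?_
  rw [map_sum, Finset.sum_eq_single ω]
  · rw [map_smul]
    congr 1
    change (freqProj hH ω * freqProj hH ω) (S β) = _
    rw [freqProj_mul_freqProj, if_pos rfl]
  · intro ω' _ hne
    rw [map_smul]
    change _ • (freqProj hH ω * freqProj hH ω') (S β) = _
    rw [freqProj_mul_freqProj, if_neg hne.symm]
    simp
  · exact fun h => absurd hω h

theorem redfield_eq_sum (H : Matrix n n ℂ) (S : ι → Matrix n n ℂ) (C : ι → ι → ℝ → ℂ) :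
    redfield H S C = ∑ α, (sandwich (S α) (bathOp H S C α)ᴴ + sandwich (bathOp H S C α) (S α)
      - sandwich (S α * bathOp H S C α) 1 - sandwich 1 ((bathOp H S C α)ᴴ * S α)) := by
  rw [redfield]
  refine Finset.sum_congr rfl fun α _ => ?_
  rw [commSup, sub_mul, mul_sub, mul_sub]
  simp only [sandwich_mul_sandwich, mul_one, one_mul]
  abel

/-- The Redfield dissipator averages to the secular one, Lamb shift included. -/
theorem zenoAverage_redfield (hH : H.IsHermitian) {S : ι → Matrix n n ℂ}
    (hS : ∀ α, (S α).IsHermitian) {C : ι → ι → ℝ → ℂ}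
    (hC : ∀ α β, IntegrableOn (C α β) (Ioi (0 : ℝ))) :
    zenoAverage hH (redfield H S C) = secular hH S C := by
  have hL : ∀ D, zenoAverage hH D = zenoAverageLin hH D := fun _ => rfl
  have h1 : zenoAverage hH (redfield H S C) = ∑ ω ∈ bohr hH, ∑ α, ∑ β,
      ((bathGamma C ω α β + star (bathGamma C ω β α)) •
          sandwich (freqProj hH ω (S β)) (freqProj hH ω (S α))ᴴ
        - bathGamma C ω α β • sandwich ((freqProj hH ω (S α))ᴴ * freqProj hH ω (S β)) 1
        - star (bathGamma C ω β α) •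
          sandwich 1 ((freqProj hH ω (S α))ᴴ * freqProj hH ω (S β))) := by
    -- The two jump terms couple equal frequencies; the two one-sided terms retain the
    -- zero-frequency part of a product, which `freqProj_zero_mul` resolves over `ω`.
    have h2 : zenoAverage hH (redfield H S C) = ∑ α, ∑ ω ∈ bohr hH,
        (sandwich (freqProj hH ω (S α)) (freqProj hH ω (bathOp H S C α))ᴴ
          + sandwich (freqProj hH ω (bathOp H S C α)) (freqProj hH ω (S α))ᴴ
          - sandwich ((freqProj hH ω (S α))ᴴ * freqProj hH ω (bathOp H S C α)) 1
          - sandwich 1 ((freqProj hH ω (bathOp H S C α))ᴴ * freqProj hH ω (S α))) := by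
      rw [redfield_eq_sum, hL, map_sum]
      refine Finset.sum_congr rfl fun α _ => ?_
      rw [map_sub, map_sub, map_add]
      simp only [← hL]
      rw [zenoAverage_sandwich_one_right, zenoAverage_sandwich_one_left]
      simp only [zenoAverage_sandwich, freqProj_zero_mul, Matrix.conjTranspose_conjTranspose,
        (hS _).eq, sandwich_sum_left, sandwich_sum_right, Finset.sum_add_distrib,
        Finset.sum_sub_distrib]
    rw [h2, Finset.sum_comm]
    refine Finset.sum_congr rfl fun ω hω => ?_
    simp only [freqProj_bathOp hH S hC _ hω, Matrix.conjTranspose_sum, Matrix.conjTranspose_smul,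
      Finset.mul_sum, Finset.sum_mul, mul_smul_comm, smul_mul_assoc, sandwich_sum_left,
      sandwich_sum_right, sandwich_smul_left, sandwich_smul_right, Finset.sum_add_distrib,
      Finset.sum_sub_distrib, add_smul]
    -- Exchanging `α` and `β` turns the conjugated coefficients into `Γ_{βα}(ω)^*`, as in `γ` and
    -- `σ`.
    have e1 : ∑ α, ∑ β, star (bathGamma C ω α β) •
        sandwich (freqProj hH ω (S α)) (freqProj hH ω (S β))ᴴ
      = ∑ α, ∑ β, star (bathGamma C ω β α) •
        sandwich (freqProj hH ω (S β)) (freqProj hH ω (S α))ᴴ := Finset.sum_comm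
    have e2 : ∑ α, ∑ β, star (bathGamma C ω α β) •
        sandwich 1 ((freqProj hH ω (S β))ᴴ * freqProj hH ω (S α))
      = ∑ α, ∑ β, star (bathGamma C ω β α) •
        sandwich 1 ((freqProj hH ω (S α))ᴴ * freqProj hH ω (S β)) := Finset.sum_comm
    rw [e1, e2]
    abel
  rw [h1, secular, lambShift]
  simp only [commSup_sum, commSup_smul, Finset.smul_sum, ← Finset.sum_sub_distrib]
  refine Finset.sum_congr rfl fun ω _ => Finset.sum_congr rfl fun α _ =>
    Finset.sum_congr rfl fun β _ => ?_
  rw [smul_smul, commSup, anticommSup]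
  -- With this, `-iσ - γ/2 = -Γ_{αβ}` multiplies the left action and `iσ - γ/2 = -Γ_{βα}^*` the
  -- right action.
  have hσ : -Complex.I * lambCoeff C ω α β
      = -(1 / 2) * (bathGamma C ω α β - star (bathGamma C ω β α)) := by
    rw [lambCoeff]
    field_simp
  rw [hσ, decayRate]
  module

end Redfield

/-! ### Half-line integrals of functions of positive type -/

section PositiveType

/-- Riemann sums of a continuous function on the unit interval. -/
theorem tendsto_riemannSum {φ : ℝ → ℝ} (hφ : Continuous φ) :
    Tendsto (fun r : ℕ => (r : ℝ)⁻¹ * ∑ k ∈ Finset.range r, φ (k / r)) atTop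
      (𝓝 (∫ u in (0 : ℝ)..1, φ u)) := by
  rw [Metric.tendsto_atTop]
  intro ε hε
  have huc := isCompact_Icc.uniformContinuousOn_of_continuous (s := Icc (0 : ℝ) 1) hφ.continuousOn
  obtain ⟨δ, hδ, hd⟩ := Metric.uniformContinuousOn_iff.1 huc (ε / 2) (half_pos hε)
  obtain ⟨R, hR⟩ := exists_nat_gt δ⁻¹
  refine ⟨R + 1, fun r hr => ?_⟩
  have hr0 : (0 : ℝ) < r := Nat.cast_pos.2 (by omega)
  have hrR : (R : ℝ) ≤ r := Nat.cast_le.2 (by omega)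
  have hrδ : (r : ℝ)⁻¹ < δ := inv_lt_of_inv_lt₀ hδ (hR.trans_le hrR)
  have hsplit : ∫ u in (0 : ℝ)..1, φ u
      = ∑ k ∈ Finset.range r, ∫ u in (k / r : ℝ)..((k + 1 : ℕ) / r : ℝ), φ u := by
    rw [intervalIntegral.sum_integral_adjacent_intervals (a := fun k : ℕ => (k / r : ℝ))
      fun k _ => hφ.intervalIntegrable _ _]
    simp [div_self hr0.ne']
  rw [hsplit, Finset.mul_sum, dist_eq_norm, ← Finset.sum_sub_distrib]
  have hterm : ∀ k ∈ Finset.range r,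
      ‖(r : ℝ)⁻¹ * φ (k / r) - ∫ u in (k / r : ℝ)..((k + 1 : ℕ) / r : ℝ), φ u‖
        ≤ ε / 2 * (r : ℝ)⁻¹ := by
    intro k hk
    have hk' : ((k + 1 : ℕ) : ℝ) ≤ r := Nat.cast_le.2 (Finset.mem_range.1 hk)
    have hlen : ((k + 1 : ℕ) / r : ℝ) - k / r = (r : ℝ)⁻¹ := by
      push_cast; field_simp; ring
    have hconst : (r : ℝ)⁻¹ * φ (k / r)
        = ∫ _ in (k / r : ℝ)..((k + 1 : ℕ) / r : ℝ), φ (k / r) := by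
      rw [intervalIntegral.integral_const, hlen, smul_eq_mul]
    rw [hconst, ← intervalIntegral.integral_sub intervalIntegrable_const
      (hφ.intervalIntegrable _ _)]
    have hle : (k / r : ℝ) ≤ ((k + 1 : ℕ) / r : ℝ) := by
      have := inv_pos.2 hr0
      linarith
    have := intervalIntegral.norm_integral_le_of_norm_le_const (a := (k / r : ℝ))
      (b := ((k + 1 : ℕ) / r : ℝ)) (C := ε / 2) (f := fun u => φ (k / r) - φ u) (by
        intro u hu
        rw [uIoc_of_le hle] at hu
        have h0 : (0 : ℝ) ≤ k / r := by positivity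
        have h1 : ((k + 1 : ℕ) / r : ℝ) ≤ 1 := (div_le_one hr0).2 hk'
        refine (hd (k / r) ⟨h0, hle.trans h1⟩ u ⟨h0.trans hu.1.le, hu.2.trans h1⟩ ?_).le
        rw [Real.dist_eq, abs_sub_comm, abs_of_pos (sub_pos.2 hu.1)]
        linarith [hu.2])
    rwa [hlen, abs_of_pos (inv_pos.2 hr0)] at this
  refine (norm_sum_le_of_le _ hterm).trans_lt ?_
  rw [Finset.sum_const, Finset.card_range, nsmul_eq_mul]
  field_simp
  linarith

/-- Each difference `±k` with `k > 0` occurs `r - k` times on either side; the diagonal is counted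
twice in the folded sum, hence the correction `r * a 0`. -/
theorem sum_sum_even (a : ℝ → ℝ) (ha : ∀ x, a (-x) = a x) (h : ℝ) (r : ℕ) :
    ∑ i ∈ Finset.range r, ∑ j ∈ Finset.range r, a (i * h - j * h)
      = 2 * ∑ k ∈ Finset.range r, ((r : ℝ) - k) * a (k * h) - r * a 0 := by
  induction r with
  | zero => simp
  | succ r ih =>
    have hrow : ∑ j ∈ Finset.range r, a (r * h - j * h)
        = ∑ k ∈ Finset.range r, a ((k + 1 : ℕ) * h) := by
      rw [← Finset.sum_range_reflect]
      refine Finset.sum_congr rfl fun j hj => ?_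
      have : ((r - 1 - j : ℕ) : ℝ) = r - 1 - j := by
        have := Finset.mem_range.1 hj
        rw [Nat.cast_sub (by omega), Nat.cast_sub (by omega)]
        simp
      rw [this]
      congr 1
      push_cast
      ring
    have hcol : ∑ i ∈ Finset.range r, a (i * h - r * h)
        = ∑ k ∈ Finset.range r, a ((k + 1 : ℕ) * h) := by
      rw [← hrow]
      refine Finset.sum_congr rfl fun i _ => ?_
      rw [← ha, neg_sub]
    have hshift := Finset.sum_range_succ' (fun k : ℕ => a (k * h)) r
    rw [Finset.sum_range_succ] at hshift
    simp only [Nat.cast_zero, zero_mul] at hshift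
    simp only [Finset.sum_range_succ, Finset.sum_add_distrib, ih, hrow, hcol, sub_self]
    have hexp : ∑ k ∈ Finset.range r, (((r + 1 : ℕ) : ℝ) - k) * a (k * h)
        = ∑ k ∈ Finset.range r, ((r : ℝ) - k) * a (k * h)
          + ∑ k ∈ Finset.range r, a (k * h) := by
      rw [← Finset.sum_add_distrib]
      refine Finset.sum_congr rfl fun k _ => ?_
      push_cast
      ring
    rw [hexp]
    push_cast at hshift ⊢
    linarith

variable {g : ℝ → ℂ}

theorem re_neg_of_positiveType
    (hpos : ∀ (r : ℕ) (t : Fin r → ℝ) (c : Fin r → ℂ),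
      0 ≤ ∑ i, ∑ j, star (c i) * g (t i - t j) * c j) (τ : ℝ) :
    (g (-τ)).re = (g τ).re := by
  have h1 := (Complex.le_def.1 (hpos 1 ![0] ![1])).2
  -- The coefficients `1, i` make the imaginary part of the quadratic form equal to `2 Im g(0) + Re
  -- g(τ) - Re g(-τ)`; it must vanish, and so must `Im g(0)` by `h1`.
  have h2 := (Complex.le_def.1 (hpos 2 ![τ, 0] ![1, Complex.I])).2
  simp [Fin.sum_univ_two] at h1 h2
  linarith

/-- Positivity with unit coefficients at the times `kT/r` counts each difference with triangular
weight, so it yields Riemann sums of this integral. The diagonal correction is of order `1/r`. -/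
theorem integral_fejer_nonneg (hg : Continuous g)
    (hpos : ∀ (r : ℕ) (t : Fin r → ℝ) (c : Fin r → ℂ),
      0 ≤ ∑ i, ∑ j, star (c i) * g (t i - t j) * c j) (T : ℝ) :
    0 ≤ ∫ u in (0 : ℝ)..1, (1 - u) * (g (u * T)).re := by
  have hcont : Continuous fun u : ℝ => (1 - u) * (g (u * T)).re := by fun_prop
  have h1 := tendsto_riemannSum hcont
  have h2 : Tendsto (fun r : ℕ => (r : ℝ)⁻¹ * ((g 0).re / 2)) atTop (𝓝 0) := by
    simpa using (tendsto_inv_atTop_zero.comp tendsto_natCast_atTop_atTop).mul_const ((g 0).re / 2)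
  refine le_of_tendsto_of_tendsto h2 h1 ?_
  filter_upwards [eventually_gt_atTop 0] with r hr
  have hr0 : (0 : ℝ) < r := Nat.cast_pos.2 hr
  refine mul_le_mul_of_nonneg_left ?_ (inv_pos.2 hr0).le
  have hS := (Complex.le_def.1 (hpos r (fun i => (i : ℕ) * (T / r)) (fun _ => 1))).1
  simp only [star_one, one_mul, mul_one, Complex.re_sum, Complex.zero_re] at hS
  have hS2 : 0 ≤ ∑ i ∈ Finset.range r, ∑ j ∈ Finset.range r,
      (g (i * (T / r) - j * (T / r))).re := by
    rw [Finset.sum_range fun i : ℕ => ∑ j ∈ Finset.range r, (g (i * (T / r) - j * (T / r))).re]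
    refine hS.trans_eq (Finset.sum_congr rfl fun i _ => ?_)
    rw [Finset.sum_range]
  rw [sum_sum_even (fun x => (g x).re) (re_neg_of_positiveType hpos)] at hS2
  have hfin : ∑ k ∈ Finset.range r, ((r : ℝ) - k) * (g (k * (T / r))).re
      = r * ∑ k ∈ Finset.range r, (1 - (k / r : ℝ)) * (g (k / r * T)).re := by
    rw [Finset.mul_sum]
    refine Finset.sum_congr rfl fun k _ => ?_
    rw [← mul_assoc, mul_sub, mul_one, mul_div_cancel₀ _ hr0.ne', div_mul_eq_mul_div,
      mul_div_assoc]
  rw [hfin] at hS2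
  have : 0 ≤ (r : ℝ) * (2 * (∑ k ∈ Finset.range r, (1 - (k / r : ℝ)) * (g (k / r * T)).re)
      - (g 0).re) := by linarith
  have := nonneg_of_mul_nonneg_right this hr0
  linarith

/-- The half-line integral of an integrable continuous function of positive type has nonnegative
real part. -/
theorem integral_re_nonneg_of_positiveType (hg : Continuous g) (hint : IntegrableOn g (Ioi 0))
    (hpos : ∀ (r : ℕ) (t : Fin r → ℝ) (c : Fin r → ℂ),
      0 ≤ ∑ i, ∑ j, star (c i) * g (t i - t j) * c j) :
    0 ≤ ∫ τ in Ioi (0 : ℝ), (g τ).re := by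
  -- The Fejér weights `1 - τ/m` on `(0, m]` increase to 1, and dominated convergence recovers the
  -- full integral.
  have hlim : Tendsto (fun m : ℕ => ∫ τ in Ioi (0 : ℝ),
      (Iic (m : ℝ)).indicator (fun τ => (1 - τ / m) * (g τ).re) τ) atTop
      (𝓝 (∫ τ in Ioi (0 : ℝ), (g τ).re)) := by
    refine tendsto_integral_of_dominated_convergence (fun τ => ‖g τ‖) ?_ hint.norm ?_ ?_
    · intro m
      exact (Continuous.aestronglyMeasurable (by fun_prop)).indicator measurableSet_Iic
    · intro m
      filter_upwards [ae_restrict_mem measurableSet_Ioi] with τ hτ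
      have hτ0 : 0 < τ := hτ
      rw [indicator_apply]
      split_ifs with h
      · have hm : (0 : ℝ) < m := hτ0.trans_le h
        have h1 : τ / m ≤ 1 := (div_le_one hm).2 h
        have h0 : 0 ≤ τ / m := by positivity
        rw [norm_mul, Real.norm_of_nonneg (by linarith)]
        calc (1 - τ / m) * ‖(g τ).re‖ ≤ 1 * ‖g τ‖ :=
              mul_le_mul (by linarith) (Complex.abs_re_le_norm _) (norm_nonneg _) zero_le_one
          _ = _ := one_mul _
      · simp
    · filter_upwards with τ
      have h1 : Tendsto (fun m : ℕ => (1 - τ / m) * (g τ).re) atTop (𝓝 ((1 - 0) * (g τ).re)) :=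
        ((tendsto_const_nhds.div_atTop tendsto_natCast_atTop_atTop).const_sub 1).mul_const _
      rw [sub_zero, one_mul] at h1
      refine h1.congr' ?_
      obtain ⟨M, hM⟩ := exists_nat_ge τ
      filter_upwards [eventually_ge_atTop M] with m hm
      rw [indicator_of_mem]
      exact hM.trans (Nat.cast_le.2 hm)
  refine ge_of_tendsto hlim ?_
  filter_upwards [eventually_gt_atTop 0] with m hm
  have hm0 : (0 : ℝ) < m := Nat.cast_pos.2 hm
  rw [setIntegral_indicator measurableSet_Iic, Ioi_inter_Iic,
    ← intervalIntegral.integral_of_le hm0.le]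
  have hsub := intervalIntegral.integral_comp_mul_right (a := 0) (b := 1)
    (fun τ => (1 - τ / m) * (g τ).re) hm0.ne'
  rw [zero_mul, one_mul] at hsub
  have hF := integral_fejer_nonneg hg hpos m
  have heq : ∫ u in (0 : ℝ)..1, (1 - u) * (g (u * m)).re
      = ∫ u in (0 : ℝ)..1, (1 - u * m / m) * (g (u * m)).re := by
    refine intervalIntegral.integral_congr fun u _ => ?_
    simp only [mul_div_cancel_right₀ _ hm0.ne']
  rw [heq, hsub, smul_eq_mul] at hF
  exact nonneg_of_mul_nonneg_right hF (inv_pos.2 hm0)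

end PositiveType

/-! ### Positivity of the decay rates and GKLS form -/

section GKLS

variable {n ι : Type*} [Fintype n] [DecidableEq n] [Fintype ι] {H : Matrix n n ℂ}

/-- The matrix of decay rates of an environment is positive semidefinite. -/
theorem posSemidef_decayRate {C : ι → ι → ℝ → ℂ}
    (hC : ∀ α β, IntegrableOn (C α β) (Ioi (0 : ℝ))) (hcorr : IsCorrelation C) (ω : ℝ) :
    (Matrix.of (decayRate C ω)).PosSemidef := by
  refine Matrix.PosSemidef.of_dotProduct_mulVec_nonneg ?_ fun x => ?_
  · ext α β
    simp [decayRate, add_comm]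
  · let g : ℝ → ℂ := fun τ => ∑ α, ∑ β,
      star (x α) * (C α β τ * Complex.exp (-Complex.I * ω * τ)) * x β
    have hcont : Continuous g := by
      have := hcorr.1
      fun_prop
    have hint1 : ∀ α β, IntegrableOn (fun τ : ℝ =>
        star (x α) * (C α β τ * Complex.exp (-Complex.I * ω * τ)) * x β) (Ioi 0) := fun α β =>
      ((integrableOn_mul_exp (hC α β) ω).const_mul _).mul_const _
    have hint : IntegrableOn g (Ioi 0) :=
      integrable_finsetSum _ fun α _ => integrable_finsetSum _ fun β _ => hint1 α β
    have hpos : ∀ (r : ℕ) (t : Fin r → ℝ) (c : Fin r → ℂ),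
        0 ≤ ∑ i, ∑ j, star (c i) * g (t i - t j) * c j := by
      intro r t c
      -- The modulation `e^{-iω(t_i - t_j)}` factors over `i` and `j`, so the coefficients absorb it
      -- and `g` is again of positive type.
      refine (hcorr.2 r t fun i α => c i * Complex.exp (Complex.I * ω * t i) * x α).trans_eq ?_
      refine Finset.sum_congr rfl fun i _ => Finset.sum_congr rfl fun j _ => ?_
      simp only [g, Finset.mul_sum, Finset.sum_mul]
      refine Finset.sum_congr rfl fun α _ => Finset.sum_congr rfl fun β _ => ?_
      have e : Complex.exp (-Complex.I * ω * ((t i - t j : ℝ) : ℂ))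
          = star (Complex.exp (Complex.I * ω * t i)) * Complex.exp (Complex.I * ω * t j) := by
        rw [Complex.star_def, ← Complex.exp_conj, ← Complex.exp_add]
        congr 1
        simp only [map_mul, Complex.conj_I, Complex.conj_ofReal]
        push_cast
        ring
      rw [e, star_mul', star_mul']
      ring
    have hΓ : ∫ τ in Ioi (0 : ℝ), g τ = ∑ α, ∑ β, star (x α) * bathGamma C ω α β * x β := by
      simp only [g]
      rw [integral_finsetSum _ fun α _ => integrable_finsetSum _ fun β _ => hint1 α β]
      refine Finset.sum_congr rfl fun α _ => ?_
      rw [integral_finsetSum _ fun β _ => hint1 α β]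
      refine Finset.sum_congr rfl fun β _ => ?_
      rw [integral_mul_const, integral_const_mul]
      rfl
    have hq : star x ⬝ᵥ Matrix.of (decayRate C ω) *ᵥ x
        = (∫ τ in Ioi (0 : ℝ), g τ) + star (∫ τ in Ioi (0 : ℝ), g τ) := by
      rw [hΓ, star_sum]
      simp only [star_sum]
      rw [Finset.sum_comm (f := fun α β => star (star (x α) * bathGamma C ω α β * x β)),
        ← Finset.sum_add_distrib]
      simp only [dotProduct, Matrix.mulVec, Matrix.of_apply, Pi.star_apply, Finset.mul_sum]
      refine Finset.sum_congr rfl fun α _ => ?_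
      rw [← Finset.sum_add_distrib]
      refine Finset.sum_congr rfl fun β _ => ?_
      simp only [star_mul', star_star, decayRate]
      ring
    rw [hq, Complex.star_def, Complex.add_conj]
    have hre : (∫ τ in Ioi (0 : ℝ), g τ).re = ∫ τ in Ioi (0 : ℝ), (g τ).re :=
      (integral_re hint).symm
    rw [hre]
    have := integral_re_nonneg_of_positiveType hcont hint hpos
    exact_mod_cast mul_nonneg zero_le_two this

theorem isHermitian_lambShift (hH : H.IsHermitian) (S : ι → Matrix n n ℂ) (C : ι → ι → ℝ → ℂ) :
    (lambShift hH S C).IsHermitian := by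
  have hσ : ∀ ω α β, star (lambCoeff C ω α β) = lambCoeff C ω β α := by
    intro ω α β
    simp only [lambCoeff, star_mul', star_sub, star_div₀, star_one, Complex.star_def,
      Complex.conj_I, Complex.conj_conj, map_ofNat]
    field_simp
    ring
  rw [Matrix.IsHermitian, lambShift, Matrix.conjTranspose_sum]
  refine Finset.sum_congr rfl fun ω _ => ?_
  rw [Matrix.conjTranspose_sum]
  simp only [Matrix.conjTranspose_sum, Matrix.conjTranspose_smul, Matrix.conjTranspose_mul,
    Matrix.conjTranspose_conjTranspose, hσ]
  exact Finset.sum_comm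

/-- All rates are taken to be 1: the jump operators already carry the weights. -/
theorem isGKLS_of_fintype {J : Type*} [Fintype J] {K : Matrix n n ℂ} (hK : K.IsHermitian)
    (V : J → Matrix n n ℂ) :
    IsGKLS ((-Complex.I) • commSup K - (1 / 2 : ℂ) • ∑ k,
      (anticommSup ((V k)ᴴ * V k) - (2 : ℂ) • sandwich (V k) (V k)ᴴ)) := by
  refine ⟨K, Fintype.card J, fun _ => 1, V ∘ (Fintype.equivFin J).symm, hK,
    fun _ => zero_le_one, ?_⟩
  congr 2
  rw [← (Fintype.equivFin J).symm.sum_comp]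
  simp

/-- A rank-one coefficient matrix `v v†` makes the double sum a single dissipator with jump operator
`∑ β, star (v β) • X β`, which diagonalizes the Kossakowski matrix. -/
theorem sum_vecMulVec_dissipator {m : ℕ} (v : Fin m → ι → ℂ) (X : ι → Matrix n n ℂ) :
    ∑ α, ∑ β, (∑ k, Matrix.vecMulVec (v k) (star (v k))) α β •
        (anticommSup ((X α)ᴴ * X β) - (2 : ℂ) • sandwich (X β) (X α)ᴴ)
      = ∑ k, (anticommSup ((∑ α, star (v k α) • X α)ᴴ * ∑ β, star (v k β) • X β)
          - (2 : ℂ) • sandwich (∑ β, star (v k β) • X β) (∑ α, star (v k α) • X α)ᴴ) := by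
  have hk : ∀ k, anticommSup ((∑ α, star (v k α) • X α)ᴴ * ∑ β, star (v k β) • X β)
          - (2 : ℂ) • sandwich (∑ β, star (v k β) • X β) (∑ α, star (v k α) • X α)ᴴ
      = ∑ α, ∑ β, (v k α * star (v k β)) •
        (anticommSup ((X α)ᴴ * X β) - (2 : ℂ) • sandwich (X β) (X α)ᴴ) := by
    intro k
    simp only [anticommSup, Matrix.conjTranspose_sum, Matrix.conjTranspose_smul, star_star,
      Finset.sum_mul, Finset.mul_sum, sandwich_sum_left, sandwich_sum_right, sandwich_smul_left,
      sandwich_smul_right, smul_mul_assoc, mul_smul_comm, smul_sub, smul_add, smul_smul,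
      Finset.smul_sum, Finset.sum_sub_distrib, Finset.sum_add_distrib]
    congr 1
    · congr 1
      · rw [Finset.sum_comm]
        refine Finset.sum_congr rfl fun _ _ => Finset.sum_congr rfl fun _ _ => ?_
        rw [mul_comm]
      · rw [Finset.sum_comm]
        refine Finset.sum_congr rfl fun _ _ => Finset.sum_congr rfl fun _ _ => ?_
        rw [mul_comm]
    · refine Finset.sum_congr rfl fun _ _ => Finset.sum_congr rfl fun _ _ => ?_
      congr 1
      ring
  simp only [hk, Matrix.sum_apply, Matrix.vecMulVec_apply, Pi.star_apply, Finset.sum_smul]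
  rw [Finset.sum_comm]
  simp_rw [Finset.sum_comm (s := Finset.univ (α := ι)) (t := Finset.univ (α := Fin m))]
  exact Finset.sum_congr rfl fun k _ => Finset.sum_comm

/-- The secular generator of an environment has GKLS form. -/
theorem isGKLS_secular (hH : H.IsHermitian) (S : ι → Matrix n n ℂ) {C : ι → ι → ℝ → ℂ}
    (hC : ∀ α β, IntegrableOn (C α β) (Ioi (0 : ℝ))) (hcorr : IsCorrelation C) (κ : ℝ) :
    IsGKLS ((κ : ℂ) • freeGen H + secular hH S C) := by
  choose m v hv using fun ω => Matrix.posSemidef_iff_eq_sum_vecMulVec.1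
    (posSemidef_decayRate hC hcorr ω)
  have hK : ((κ : ℂ) • H + lambShift hH S C).IsHermitian := by
    refine Matrix.IsHermitian.add ?_ (isHermitian_lambShift hH S C)
    rw [Matrix.IsHermitian, Matrix.conjTranspose_smul, hH.eq, Complex.star_def,
      Complex.conj_ofReal]
  have h := isGKLS_of_fintype (J := Σ ω : bohr hH, Fin (m ω)) hK
    (fun p => ∑ β, star (v p.1 p.2 β) • freqProj hH p.1 (S β))
  convert h using 1
  rw [Fintype.sum_sigma, secular, freeGen, commSup_add, commSup_smul, smul_add,
    smul_comm (κ : ℂ), ← add_sub_assoc]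
  congr 2
  rw [← Finset.sum_coe_sort]
  refine Finset.sum_congr rfl fun ω _ => ?_
  refine Eq.trans ?_ (sum_vecMulVec_dissipator (v ω) fun β => freqProj hH ω (S β))
  rw [← hv]
  rfl

end GKLS

/-! ### The trace norm as the dual of the operator norm -/

section TraceNorm

variable {k : Type*} [Fintype k] [DecidableEq k]

/-- The operator on the Euclidean space given by a matrix. -/
noncomputable abbrev euclideanOp (A : Matrix k k ℂ) :
    EuclideanSpace ℂ k →L[ℂ] EuclideanSpace ℂ k :=
  Matrix.toEuclideanCLM (n := k) (𝕜 := ℂ) A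

/-- Contractions of the Euclidean space. -/
def IsContraction (B : Matrix k k ℂ) : Prop := ∀ x, ‖euclideanOp B x‖ ≤ ‖x‖

theorem IsContraction.mul {A B : Matrix k k ℂ} (hA : IsContraction A) (hB : IsContraction B) :
    IsContraction (A * B) := by
  intro x
  rw [euclideanOp, map_mul]
  exact (hA _).trans (hB x)

theorem inner_euclideanOp (A B : Matrix k k ℂ) (x y : EuclideanSpace ℂ k) :
    inner ℂ (euclideanOp A x) (euclideanOp B y) = inner ℂ x (euclideanOp (Aᴴ * B) y) := by
  rw [euclideanOp, euclideanOp, euclideanOp, map_mul, ← Matrix.star_eq_conjTranspose, map_star,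
    ContinuousLinearMap.star_eq_adjoint]
  exact (ContinuousLinearMap.adjoint_inner_right _ _ _).symm

theorem isContraction_of_isometry {B : Matrix k k ℂ} (hB : Bᴴ * B = 1) : IsContraction B := by
  intro x
  have h := inner_euclideanOp B B x x
  rw [hB, euclideanOp, euclideanOp, map_one, one_apply_eq_self, inner_self_eq_norm_sq_to_K,
    inner_self_eq_norm_sq_to_K] at h
  have h' : ‖euclideanOp B x‖ ^ 2 = ‖x‖ ^ 2 := by exact_mod_cast h
  exact ((sq_eq_sq₀ (norm_nonneg _) (norm_nonneg _)).1 h').le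

theorem isContraction_single (i j : k) : IsContraction (Matrix.single i j (1 : ℂ)) := by
  intro x
  have : euclideanOp (Matrix.single i j (1 : ℂ)) x = EuclideanSpace.single i (x j) := by
    ext a
    rw [euclideanOp, Matrix.ofLp_toEuclideanCLM, Matrix.single_mulVec]
    simp [Function.update_apply]
  rw [this, PiLp.norm_single]
  exact PiLp.norm_apply_le x j

theorem trace_eq_sum_inner (A : Matrix k k ℂ)
    (b : OrthonormalBasis k ℂ (EuclideanSpace ℂ k)) :
    A.trace = ∑ i, inner ℂ (b i) (euclideanOp A (b i)) := by
  have h := LinearMap.trace_eq_sum_inner (Matrix.toEuclideanLin A) b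
  have h2 : LinearMap.trace ℂ _ (Matrix.toEuclideanLin A) = A.trace :=
    Matrix.trace_toLin_eq A (PiLp.basisFun 2 ℂ k)
  rw [← h2, h]
  rfl

/-- The right singular vectors of a matrix. -/
noncomputable def singularBasis (A : Matrix k k ℂ) :
    OrthonormalBasis k ℂ (EuclideanSpace ℂ k) :=
  (Matrix.isHermitian_conjTranspose_mul_self A).eigenvectorBasis

/-- The singular values of a matrix. -/
noncomputable def singularValue (A : Matrix k k ℂ) (i : k) : ℝ :=
  √((Matrix.isHermitian_conjTranspose_mul_self A).eigenvalues i)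

theorem inner_euclideanOp_singularBasis (A : Matrix k k ℂ) (i j : k) :
    inner ℂ (euclideanOp A (singularBasis A i)) (euclideanOp A (singularBasis A j))
      = if i = j then ((singularValue A j : ℂ)) ^ 2 else 0 := by
  rw [inner_euclideanOp]
  have h : euclideanOp (Aᴴ * A) (singularBasis A j)
      = ((singularValue A j : ℂ) ^ 2) • singularBasis A j := by
    have h1 := (Matrix.isHermitian_conjTranspose_mul_self A).mulVec_eigenvectorBasis j
    have h2 : (singularValue A j) ^ 2
        = (Matrix.isHermitian_conjTranspose_mul_self A).eigenvalues j :=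
      Real.sq_sqrt ((Matrix.posSemidef_conjTranspose_mul_self A).eigenvalues_nonneg j)
    ext a
    rw [euclideanOp, Matrix.ofLp_toEuclideanCLM]
    have h3 := congrFun h1 a
    rw [← h2] at h3
    refine h3.trans ?_
    simp [singularBasis]
  rw [h, inner_smul_right, orthonormal_iff_ite.1 (singularBasis A).orthonormal i j]
  simp

theorem norm_euclideanOp_singularBasis (A : Matrix k k ℂ) (i : k) :
    ‖euclideanOp A (singularBasis A i)‖ = singularValue A i := by
  have h := inner_euclideanOp_singularBasis A i i
  rw [if_pos rfl, inner_self_eq_norm_sq_to_K] at h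
  have h' : ‖euclideanOp A (singularBasis A i)‖ ^ 2 = singularValue A i ^ 2 :=
    Complex.ofReal_injective (by push_cast; exact h)
  exact (sq_eq_sq₀ (norm_nonneg _) (Real.sqrt_nonneg _)).1 h'

/-- In the right singular basis the diagonal terms of `B * A` are bounded by `‖B A v_i‖ ≤ ‖A v_i‖`,
the singular values. -/
theorem norm_trace_mul_le {A B : Matrix k k ℂ} (hB : IsContraction B) :
    ‖(B * A).trace‖ ≤ traceNorm A := by
  rw [trace_eq_sum_inner (B * A) (singularBasis A)]
  refine norm_sum_le_of_le _ fun i _ => ?_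
  refine (norm_inner_le_norm _ _).trans ?_
  rw [(singularBasis A).orthonormal.1 i, one_mul, euclideanOp, map_mul]
  exact (hB _).trans (norm_euclideanOp_singularBasis A i).le

/-- The trace norm is attained on a contraction. -/
theorem exists_contraction_trace_mul (A : Matrix k k ℂ) :
    ∃ B : Matrix k k ℂ, IsContraction B ∧ (B * A).trace = traceNorm A := by
  -- These are the left singular vectors. Where the singular value is 0 the inverse is 0 and so is
  -- `u i`; the map `L` sending `u i` to the right singular vectors is a partial isometry, bounded
  -- by Bessel's inequality.
  let u : k → EuclideanSpace ℂ k := fun i =>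
    ((singularValue A i : ℂ)⁻¹) • euclideanOp A (singularBasis A i)
  let L : EuclideanSpace ℂ k →L[ℂ] EuclideanSpace ℂ k :=
    ∑ i, (innerSL ℂ (u i)).smulRight (singularBasis A i)
  have hL : ∀ x, L x = ∑ i, inner ℂ (u i) x • singularBasis A i := by
    intro x
    simp [L]
  obtain ⟨B, hB⟩ := (Matrix.toEuclideanCLM (n := k) (𝕜 := ℂ)).surjective L
  have hBx : ∀ x, euclideanOp B x = ∑ i, inner ℂ (u i) x • singularBasis A i := by
    intro x
    rw [← hL, ← hB]
    rfl
  have hin : ∀ i x, inner ℂ (singularBasis A i) (euclideanOp B x) = inner ℂ (u i) x := by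
    intro i x
    rw [hBx]
    exact (singularBasis A).orthonormal.inner_right_fintype _ i
  refine ⟨B, fun x => ?_, ?_⟩
  · have hon : Orthonormal ℂ (fun i : {i // singularValue A i ≠ 0} => u i) := by
      rw [orthonormal_iff_ite]
      intro i j
      simp only [u, inner_smul_left, inner_smul_right, inner_euclideanOp_singularBasis]
      by_cases h : i = j
      · subst h
        have : (singularValue A i : ℂ) ≠ 0 := Complex.ofReal_ne_zero.2 i.2
        simp only [if_true, map_inv₀, Complex.conj_ofReal]
        field_simp
      · have h' : (i : k) ≠ j := fun e => h (Subtype.ext e)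
        simp [h, h']
    have h1 : ‖euclideanOp B x‖ ^ 2 = ∑ i, ‖inner ℂ (u i) x‖ ^ 2 := by
      rw [← (singularBasis A).sum_sq_norm_inner_right]
      simp only [hin]
    have h2 : ∑ i, ‖inner ℂ (u i) x‖ ^ 2
        = ∑ i : {i // singularValue A i ≠ 0}, ‖inner ℂ (u i) x‖ ^ 2 := by
      rw [← Finset.sum_filter_of_ne (p := fun i => singularValue A i ≠ 0)]
      · exact Finset.sum_subtype _ (by simp) _
      · intro i _ hi h0
        simp [u, h0] at hi
    rw [← sq_le_sq₀ (norm_nonneg _) (norm_nonneg _), h1, h2]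
    exact hon.sum_inner_products_le x
  · rw [trace_eq_sum_inner (B * A) (singularBasis A), traceNorm, Complex.ofReal_sum]
    refine Finset.sum_congr rfl fun i _ => ?_
    have : euclideanOp (B * A) (singularBasis A i)
        = euclideanOp B (euclideanOp A (singularBasis A i)) := by
      rw [euclideanOp, map_mul]; rfl
    rw [this, hin, inner_smul_left, inner_euclideanOp_singularBasis, if_pos rfl, map_inv₀,
      Complex.conj_ofReal]
    change (singularValue A i : ℂ)⁻¹ * _ = (singularValue A i : ℂ)
    by_cases h : (singularValue A i : ℂ) = 0
    · rw [h]; simp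
    · field_simp

theorem traceNorm_nonneg (A : Matrix k k ℂ) : 0 ≤ traceNorm A :=
  Finset.sum_nonneg fun _ _ => Real.sqrt_nonneg _

theorem traceNorm_le {A : Matrix k k ℂ} {c : ℝ}
    (h : ∀ B : Matrix k k ℂ, IsContraction B → ‖(B * A).trace‖ ≤ c) : traceNorm A ≤ c := by
  obtain ⟨B, hB, hBA⟩ := exists_contraction_trace_mul A
  have := h B hB
  rwa [hBA, Complex.norm_real, Real.norm_of_nonneg (traceNorm_nonneg A)] at this

theorem traceNorm_add_le (A A' : Matrix k k ℂ) :
    traceNorm (A + A') ≤ traceNorm A + traceNorm A' :=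
  traceNorm_le fun B hB => by
    rw [mul_add, Matrix.trace_add]
    exact (norm_add_le _ _).trans (add_le_add (norm_trace_mul_le hB) (norm_trace_mul_le hB))

theorem traceNorm_smul_le (c : ℂ) (A : Matrix k k ℂ) :
    traceNorm (c • A) ≤ ‖c‖ * traceNorm A :=
  traceNorm_le fun B hB => by
    rw [mul_smul_comm, Matrix.trace_smul, norm_smul]
    exact mul_le_mul_of_nonneg_left (norm_trace_mul_le hB) (norm_nonneg c)

theorem traceNorm_zero : traceNorm (0 : Matrix k k ℂ) = 0 :=
  le_antisymm (traceNorm_le fun B _ => by simp) (traceNorm_nonneg _)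

theorem traceNorm_smul (c : ℂ) (A : Matrix k k ℂ) :
    traceNorm (c • A) = ‖c‖ * traceNorm A := by
  by_cases hc : c = 0
  · rw [hc, zero_smul, traceNorm_zero, norm_zero, zero_mul]
  · refine le_antisymm (traceNorm_smul_le c A) ?_
    have h := traceNorm_smul_le c⁻¹ (c • A)
    rw [smul_smul, inv_mul_cancel₀ hc, one_smul, norm_inv] at h
    rwa [← le_inv_mul_iff₀ (norm_pos_iff.2 hc)]

theorem traceNorm_sum_le {ι : Type*} (s : Finset ι) (A : ι → Matrix k k ℂ) :
    traceNorm (∑ i ∈ s, A i) ≤ ∑ i ∈ s, traceNorm (A i) :=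
  Finset.le_sum_of_subadditive traceNorm traceNorm_zero.le traceNorm_add_le s A

/-- By cyclicity `tr(B U A W) = tr(W B U A)`, and `W B U` is again a contraction. -/
theorem traceNorm_mul_mul_le {U W : Matrix k k ℂ} (hU : IsContraction U) (hW : IsContraction W)
    (A : Matrix k k ℂ) : traceNorm (U * A * W) ≤ traceNorm A :=
  traceNorm_le fun B hB => by
    rw [← mul_assoc, Matrix.trace_mul_comm, ← mul_assoc, ← mul_assoc]
    exact norm_trace_mul_le ((hW.mul hB).mul hU)

theorem norm_apply_le_traceNorm (A : Matrix k k ℂ) (i j : k) : ‖A i j‖ ≤ traceNorm A := by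
  have h := norm_trace_mul_le (A := A) (isContraction_single j i)
  rwa [Matrix.trace_single_mul, one_smul] at h

theorem eq_zero_of_traceNorm_eq_zero {A : Matrix k k ℂ} (h : traceNorm A = 0) : A = 0 := by
  ext i j
  have := norm_apply_le_traceNorm A i j
  rw [h] at this
  exact norm_le_zero_iff.1 this

end TraceNorm

/-! ### The diamond norm as an algebra norm -/

section DiamondNorm

variable {n : Type*} [Fintype n] [DecidableEq n]

/-- `ampliation Φ` as a linear map. -/
noncomputable def ampliationLin (Φ : Superop n) :
    Matrix (n × n) (n × n) ℂ →ₗ[ℂ] Matrix (n × n) (n × n) ℂ where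
  toFun := ampliation Φ
  map_add' A B := by
    ext p q
    have : Matrix.of (fun i j => (A + B) (i, p.2) (j, q.2))
        = Matrix.of (fun i j => A (i, p.2) (j, q.2))
          + Matrix.of (fun i j => B (i, p.2) (j, q.2)) := rfl
    change Φ (Matrix.of fun i j => (A + B) (i, p.2) (j, q.2)) p.1 q.1 = _
    rw [this, map_add]
    rfl
  map_smul' c A := by
    ext p q
    have : Matrix.of (fun i j => (c • A) (i, p.2) (j, q.2))
        = c • Matrix.of (fun i j => A (i, p.2) (j, q.2)) := rfl
    change Φ (Matrix.of fun i j => (c • A) (i, p.2) (j, q.2)) p.1 q.1 = _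
    rw [this, map_smul]
    rfl

/-- This makes the set defining the diamond norm bounded above, without which its `sSup` would be
the default value 0. -/
theorem exists_traceNorm_ampliation_le (Φ : Superop n) :
    ∃ c, ∀ A, traceNorm (ampliation Φ A) ≤ c * traceNorm A := by
  refine ⟨∑ p, ∑ q, traceNorm (ampliation Φ (Matrix.single p q 1)), fun A => ?_⟩
  have hA : ampliation Φ A
      = ∑ p, ∑ q, A p q • ampliation Φ (Matrix.single p q 1) := by
    change ampliationLin Φ A = ∑ p, ∑ q, A p q • ampliationLin Φ (Matrix.single p q 1)
    conv_lhs => rw [Matrix.matrix_eq_sum_single A]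
    simp only [map_sum, ← map_smul, Matrix.smul_single, smul_eq_mul, mul_one]
  rw [hA, Finset.sum_mul]
  refine (traceNorm_sum_le _ _).trans (Finset.sum_le_sum fun p _ => ?_)
  rw [Finset.sum_mul]
  refine (traceNorm_sum_le _ _).trans (Finset.sum_le_sum fun q _ => ?_)
  rw [traceNorm_smul, mul_comm]
  exact mul_le_mul_of_nonneg_left (norm_apply_le_traceNorm A p q) (traceNorm_nonneg _)

theorem diamondNorm_nonneg (Φ : Superop n) : 0 ≤ diamondNorm Φ :=
  Real.sSup_nonneg (by rintro _ ⟨A, _, rfl⟩; exact traceNorm_nonneg _)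

theorem diamondNorm_le {Φ : Superop n} {c : ℝ} (hc : 0 ≤ c)
    (h : ∀ A, traceNorm (ampliation Φ A) ≤ c * traceNorm A) : diamondNorm Φ ≤ c :=
  Real.sSup_le (by rintro _ ⟨A, hA, rfl⟩; simpa [hA] using h A) hc

theorem traceNorm_ampliation_le (Φ : Superop n) (A : Matrix (n × n) (n × n) ℂ) :
    traceNorm (ampliation Φ A) ≤ diamondNorm Φ * traceNorm A := by
  by_cases hA : traceNorm A = 0
  · have h0 : ampliation Φ 0 = 0 := map_zero (ampliationLin Φ)
    rw [eq_zero_of_traceNorm_eq_zero hA, h0, traceNorm_zero, mul_zero]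
  · have hpos : 0 < traceNorm A := lt_of_le_of_ne (traceNorm_nonneg A) (Ne.symm hA)
    obtain ⟨c, hc⟩ := exists_traceNorm_ampliation_le Φ
    have hbdd : BddAbove {x | ∃ A : Matrix (n × n) (n × n) ℂ,
        traceNorm A = 1 ∧ x = traceNorm (ampliation Φ A)} :=
      ⟨c, by rintro _ ⟨B, hB, rfl⟩; simpa [hB] using hc B⟩
    have hn : ‖((traceNorm A)⁻¹ : ℂ)‖ = (traceNorm A)⁻¹ := by
      rw [norm_inv, Complex.norm_real, Real.norm_of_nonneg hpos.le]
    have h1 : traceNorm (((traceNorm A)⁻¹ : ℂ) • A) = 1 := by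
      rw [traceNorm_smul, hn, inv_mul_cancel₀ hA]
    have h2 : ampliation Φ (((traceNorm A)⁻¹ : ℂ) • A)
        = ((traceNorm A)⁻¹ : ℂ) • ampliation Φ A := map_smul (ampliationLin Φ) _ A
    have h3 := le_csSup hbdd ⟨_, h1, rfl⟩
    rw [h2, traceNorm_smul, hn, inv_mul_le_iff₀ hpos, mul_comm] at h3
    exact h3

theorem ampliation_mul (Φ Ψ : Superop n) (A : Matrix (n × n) (n × n) ℂ) :
    ampliation (Φ * Ψ) A = ampliation Φ (ampliation Ψ A) := rfl

theorem ampliation_add (Φ Ψ : Superop n) (A : Matrix (n × n) (n × n) ℂ) :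
    ampliation (Φ + Ψ) A = ampliation Φ A + ampliation Ψ A := rfl

theorem ampliation_smul (c : ℂ) (Φ : Superop n) (A : Matrix (n × n) (n × n) ℂ) :
    ampliation (c • Φ) A = c • ampliation Φ A := rfl

theorem diamondNorm_smul_le (c : ℂ) (Φ : Superop n) :
    diamondNorm (c • Φ) ≤ ‖c‖ * diamondNorm Φ :=
  diamondNorm_le (mul_nonneg (norm_nonneg c) (diamondNorm_nonneg Φ)) fun A => by
    rw [ampliation_smul, traceNorm_smul, mul_assoc]
    exact mul_le_mul_of_nonneg_left (traceNorm_ampliation_le Φ A) (norm_nonneg c)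

theorem diamondNorm_zero : diamondNorm (0 : Superop n) = 0 := by
  have := diamondNorm_smul_le 0 (0 : Superop n)
  rw [norm_zero, zero_mul, zero_smul] at this
  exact le_antisymm this (diamondNorm_nonneg _)

theorem diamondNorm_smul (c : ℂ) (Φ : Superop n) :
    diamondNorm (c • Φ) = ‖c‖ * diamondNorm Φ := by
  by_cases hc : c = 0
  · rw [hc, zero_smul, diamondNorm_zero, norm_zero, zero_mul]
  · refine le_antisymm (diamondNorm_smul_le c Φ) ?_
    have h := diamondNorm_smul_le c⁻¹ (c • Φ)
    rw [smul_smul, inv_mul_cancel₀ hc, one_smul, norm_inv] at h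
    rwa [← le_inv_mul_iff₀ (norm_pos_iff.2 hc)]

theorem eq_zero_of_diamondNorm_eq_zero {Φ : Superop n} (h : diamondNorm Φ = 0) : Φ = 0 := by
  refine ContinuousLinearMap.ext fun ρ => ?_
  ext i j
  -- The test matrix is `ρ` tensored with the all-ones matrix, so every entry of `Φ ρ` appears in
  -- its image.
  have h1 := traceNorm_ampliation_le Φ (Matrix.of fun p q => ρ p.1 q.1)
  rw [h, zero_mul] at h1
  have h2 := eq_zero_of_traceNorm_eq_zero (le_antisymm h1 (traceNorm_nonneg _))
  exact congrFun (congrFun h2 (i, i)) (j, i)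

/-- The diamond norm as an algebra norm. -/
noncomputable def diamondAlgebraNorm : AlgebraNorm ℂ (Superop n) where
  toFun := diamondNorm
  map_zero' := diamondNorm_zero
  add_le' Φ Ψ := diamondNorm_le (add_nonneg (diamondNorm_nonneg _) (diamondNorm_nonneg _))
    fun A => by
      rw [ampliation_add, add_mul]
      exact (traceNorm_add_le _ _).trans
        (add_le_add (traceNorm_ampliation_le Φ A) (traceNorm_ampliation_le Ψ A))
  neg' Φ := by
    have h : -Φ = (-1 : ℂ) • Φ := (neg_one_smul ℂ Φ).symm
    rw [h, diamondNorm_smul, norm_neg, norm_one, one_mul]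
  smul' := diamondNorm_smul
  mul_le' Φ Ψ := diamondNorm_le (mul_nonneg (diamondNorm_nonneg _) (diamondNorm_nonneg _))
    fun A => by
      rw [ampliation_mul, mul_assoc]
      exact (traceNorm_ampliation_le Φ _).trans
        (mul_le_mul_of_nonneg_left (traceNorm_ampliation_le Ψ A) (diamondNorm_nonneg Φ))
  eq_zero_of_map_eq_zero' _ := eq_zero_of_diamondNorm_eq_zero

open scoped Kronecker in
theorem ampliation_sandwich (U W : Matrix n n ℂ) (A : Matrix (n × n) (n × n) ℂ) :
    ampliation (sandwich U W) A
      = (U ⊗ₖ (1 : Matrix n n ℂ)) * A * (W ⊗ₖ (1 : Matrix n n ℂ)) := by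
  ext p q
  change (U * (Matrix.of (fun i j => A (i, p.2) (j, q.2)) * W)) p.1 q.1 = _
  rw [mul_assoc]
  simp [Matrix.mul_apply, Fintype.sum_prod_type, Matrix.one_apply, Finset.sum_ite_eq]

-- Its ampliation multiplies by the isometries `U ⊗ 1` and `Uᴴ ⊗ 1`, which are contractions and
-- cannot increase the trace norm.
open scoped Kronecker in
theorem diamondNorm_sandwich_unitary_le {U : Matrix n n ℂ} (hU : Uᴴ * U = 1) :
    diamondNorm (sandwich U Uᴴ) ≤ 1 := by
  have hc : ∀ V : Matrix n n ℂ, Vᴴ * V = 1 → IsContraction (V ⊗ₖ (1 : Matrix n n ℂ)) := by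
    intro V hV
    refine isContraction_of_isometry ?_
    rw [Matrix.conjTranspose_kronecker, ← Matrix.mul_kronecker_mul, hV,
      Matrix.conjTranspose_one, mul_one, Matrix.one_kronecker_one]
  have hU' : Uᴴᴴ * Uᴴ = 1 := by
    rw [Matrix.conjTranspose_conjTranspose, mul_eq_one_comm, hU]
  refine diamondNorm_le zero_le_one fun A => ?_
  rw [ampliation_sandwich, one_mul]
  exact traceNorm_mul_mul_le (hc U hU) (hc _ hU') A

end DiamondNorm

end Secular

/-! ### Assembly of the five claims -/

theorem mainTheorem5 {n ι : Type*} [Fintype n] [DecidableEq n] [Fintype ι]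
    (H : Matrix n n ℂ) (hH : H.IsHermitian)
    (S : ι → Matrix n n ℂ) (hS : ∀ α, (S α).IsHermitian)
    (C : ι → ι → ℝ → ℂ) (hC : ∀ α β, IntegrableOn (C α β) (Ioi (0 : ℝ))) :
    -- the `freqProj hH ω`, `ω ∈ bohr hH`, are the spectral projections of the free generator
    (spectrum ℂ (Secular.freeGen H) = (fun ω : ℝ => -Complex.I * ω) '' (Secular.bohr hH : Set ℝ) ∧
      Secular.freeGen H
        = (-Complex.I) • ∑ ω ∈ Secular.bohr hH, (ω : ℂ) • Secular.freqProj hH ω ∧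
      (∑ ω ∈ Secular.bohr hH, Secular.freqProj hH ω = 1) ∧
      ∀ ω ∈ Secular.bohr hH, ∀ ω' ∈ Secular.bohr hH,
        Secular.freqProj hH ω * Secular.freqProj hH ω'
          = if ω = ω' then Secular.freqProj hH ω else 0) ∧
    -- the long-time average of the Redfield dissipator exists and equals `D_Z`
    Tendsto (fun τ : ℝ => ((τ⁻¹ : ℝ) : ℂ) • ∫ s in (0 : ℝ)..τ,
        NormedSpace.exp (-(s : ℂ) • Secular.freeGen H) * Secular.redfield H S C
          * NormedSpace.exp ((s : ℂ) • Secular.freeGen H))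
      atTop (𝓝 (Secular.zenoAverage hH (Secular.redfield H S C))) ∧
    -- `D_Z = D_sec`, including the Lamb shift
    Secular.zenoAverage hH (Secular.redfield H S C) = Secular.secular hH S C ∧
    -- the secular generator has GKLS form when the `C` are correlation functions
    (Secular.IsCorrelation C →
      ∀ κ : ℝ, Secular.IsGKLS ((κ : ℂ) • Secular.freeGen H + Secular.secular hH S C)) ∧
    -- error bound, in every superoperator norm in which the free evolution is contractive
    (∀ N : AlgebraNorm ℂ (Secular.Superop n),
      (∀ t : ℝ, 0 ≤ t → N (NormedSpace.exp ((t : ℂ) • Secular.freeGen H)) ≤ 1) →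
      ∀ κ : ℝ, 0 < κ → ∀ T : ℝ, 0 ≤ T → ∀ t ∈ Icc 0 T,
        N (NormedSpace.exp ((t : ℂ) • ((κ : ℂ) • Secular.freeGen H + Secular.redfield H S C))
            - NormedSpace.exp ((t : ℂ) • ((κ : ℂ) • Secular.freeGen H + Secular.secular hH S C)))
          ≤ Secular.errorBound hH (Secular.redfield H S C) N κ T) ∧
    -- error bound in the diamond norm
    (∀ κ : ℝ, 0 < κ → ∀ T : ℝ, 0 ≤ T → ∀ t ∈ Icc 0 T,
        Secular.diamondNorm
          (NormedSpace.exp ((t : ℂ) • ((κ : ℂ) • Secular.freeGen H + Secular.redfield H S C))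
            - NormedSpace.exp ((t : ℂ) • ((κ : ℂ) • Secular.freeGen H + Secular.secular hH S C)))
          ≤ Secular.errorBound hH (Secular.redfield H S C) Secular.diamondNorm κ T) := by
  have hZ := Secular.zenoAverage_redfield hH hS hC
  refine ⟨⟨Secular.spectrum_freeGen hH, Secular.freeGen_eq_sum hH, Secular.sum_freqProj hH,
    fun ω _ ω' _ => Secular.freqProj_mul_freqProj hH ω ω'⟩, Secular.tendsto_zenoAverage hH _, hZ,
    fun hcorr κ => Secular.isGKLS_secular hH S hC hcorr κ, ?_, ?_⟩
  · intro N hN κ hκ T _ t ht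
    rw [← hZ]
    exact Secular.algebraNorm_exp_sub_exp_zenoAverage_le hH _ N hN hκ ht.1 ht.2
  · intro κ hκ T _ t ht
    rw [← hZ]
    -- Contractivity, assumed in the general bound, holds here because the free evolution is a
    -- unitary conjugation.
    refine Secular.algebraNorm_exp_sub_exp_zenoAverage_le hH _ Secular.diamondAlgebraNorm
      (fun s _ => ?_) hκ ht.1 ht.2
    obtain ⟨U, hU, hexp⟩ := Secular.exists_unitary_exp_freeGen hH s
    rw [hexp]
    exact Secular.diamondNorm_sandwich_unitary_le hU
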